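/- Throughout, an r-matrix on $gl(k,\mathbb C)$ is a $\mathbb C$-linear map $R:gl(k,\mathbb C)\to gl(k,\mathbb C)$ that is skew-symmetric for the form $\langle X,Y\rangle=\operatorname{tr}(XY)$ and satisfies $[RX,RY]-R([RX,Y]+[X,RY])+[X,Y]=0$. Given r-matrices $R$ on $gl(n,\mathbb C)$ and $\rho$ on $gl(d,\mathbb C)$ and $\lambda\in\mathbb C$, let $\{\ ,\ \}_{R,\rho,\lambda}$ be the bracket of holomorphic functions on $\mathbb C^{n\times d}\times\mathbb C^{d\times n}=\{(v,w^T)\}$ defined by $$\{F,H\}_{R,\rho,\lambda}=\tfrac12\operatorname{tr}\Bigl(-(vx^T-\xi w^T)R(vy^T-\eta w^T)-(x^Tv-w^T\xi)\rho(y^Tv-w^T\eta)+w^Tv(x^T\eta-y^T\xi)+vw^T(\eta x^T-\xi y^T)+2\lambda(x^T\eta-y^T\xi)\Bigr),$$ where $dF(a,b)=\operatorname{tr}(x^Ta+b\,\xi)$ and $dH(a,b)=\operatorname{tr}(y^Ta+b\,\eta)$ at the point $(v,w^T)$ (and $\operatorname{tr}$ is applied to each term separately). Put $X_\pm=\frac12(RX\pm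 X)$ and let $G_R\subset GL(n,\mathbb C)\times GL(n,\mathbb C)$ be the connected Lie subgroup with Lie algebra $\{(X_+,X_-):X\in gl(n,\mathbb C)\}$. Let $R,\rho_1,\rho_2$ be r-matrices on $gl(n,\mathbb C)$, $gl(d_1,\mathbb C)$, $gl(d_2,\mathbb C)$ and let $\lambda\in\mathbb C$. Let $M=\mathbb C^{n\times d_1}\times\mathbb C^{d_1\times n}$ carry the bracket $\{\ ,\ \}_{R,\rho_1,\lambda}$, let $N=\mathbb C^{n\times d_2}\times\mathbb C^{d_2\times n}$ carry the bracket $\{\ ,\ \}_{R,\rho_2,\mu}$ with $\mu=1$, and let $M\times N$ carry their direct sum. Let $U\subset M$ be open and let $(g_+,g_-):U\to G_R$ be holomorphic with $g_+g_-^{-1}=\lambda\,\mathrm{Id}_n+vw^T$ on $U$ (a holomorphic branch of the factorization). For the standard r-matrix $R$ (strictly upper triangular part minus strictly lower triangular part), $g_+$ is upper triangular, $g_-$ is lower triangular, and their diagonals are inverse to one another: these are the Gauss factors. Define on $U\times N$ $$\Sigma(v,w^T;V,W^T)=(v,w^T;\,g_+V,\,W^Tg_-^{-1}),\qquad \mathcal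 C(v,w^T;V,W^T)=(\tilde V,\tilde W^T),\quad \tilde V=(v,V),\ \tilde W=(w,W),$$ where $g_\pm=g_\pm(v,w^T)$ and $\mathcal C$ takes values in $\tilde M=\mathbb C^{n\times(d_1+d_2)}\times\mathbb C^{(d_1+d_2)\times n}$. **Proposition.** The linear map on $gl(d_1+d_2,\mathbb C)$ $$\tilde\rho\begin{pmatrix}A_{11}&A_{12}\\A_{21}&A_{22}\end{pmatrix}=\begin{pmatrix}\rho_1(A_{11})&A_{12}\\-A_{21}&\rho_2(A_{22})\end{pmatrix}$$ is an r-matrix, and $\{\ ,\ \}_{R,\tilde\rho,\lambda}$ is a Poisson bracket on $\tilde M$. It is the bracket engendered by $\mathcal C\circ\Sigma$: this map is biholomorphic from $U\times N$ onto an open subset of $\tilde M$, and $\{F\circ\mathcal C\circ\Sigma,\,H\circ\mathcal C\circ\Sigma\}_{M\times N}=\{F,H\}_{R,\tilde\rho,\lambda}\circ\mathcal C\circ\Sigma$ at every point of $U\times N$, for all $F,H$ holomorphic near its image. In particular, for linear functions $\tilde F(\tilde V,\tilde W^T)=\operatorname{tr}(\tilde X^T\tilde V+\tilde W^T\tilde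 P)$ and $\tilde H(\tilde V,\tilde W^T)=\operatorname{tr}(\tilde Y^T\tilde V+\tilde W^T\tilde Q)$ the engendered bracket is $$\begin{aligned}\{\tilde F,\tilde H\}(\tilde V,\tilde W^T)=\tfrac12\operatorname{tr}\bigl(&-(\tilde V\tilde X^T-\tilde P\tilde W^T)R(\tilde V\tilde Y^T-\tilde Q\tilde W^T)-(\tilde X^T\tilde V-\tilde W^T\tilde P)\tilde\rho(\tilde Y^T\tilde V-\tilde W^T\tilde Q)\\&+\tilde W^T\tilde V(\tilde X^T\tilde Q-\tilde Y^T\tilde P)+\tilde V\tilde W^T(\tilde Q\tilde X^T-\tilde P\tilde Y^T)+2\lambda(\tilde X^T\tilde Q-\tilde Y^T\tilde P)\bigr).\end{aligned}$$ -/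

import Mathlib

open scoped Matrix.Norms.Operator Topology

noncomputable section

namespace SemidirectPB

/-- Points `(v, wᵀ)` with `v` an `n × d` matrix and `wᵀ` a `d × n` matrix. -/
abbrev Pairs (n d : Type*) : Type _ := Matrix n d ℂ × Matrix d n ℂ

/-- A factorizable r-matrix on `gl(n, ℂ)`: an endomorphism which is skew-symmetric for the
trace form `⟨X, Y⟩ = tr (X Y)` and satisfies the modified classical Yang-Baxter equation. -/
structure IsRMatrix {n : Type*} [Fintype n] [DecidableEq n]
    (R : Matrix n n ℂ →ₗ[ℂ] Matrix n n ℂ) : Prop where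
  skew : ∀ X Y : Matrix n n ℂ, (R X * Y).trace = -(X * R Y).trace
  yangBaxter : ∀ X Y : Matrix n n ℂ,
    ⁅R X, R Y⁆ - R (⁅R X, Y⁆ + ⁅X, R Y⁆) + ⁅X, Y⁆ = 0

/-- The component `X₊ = (R X + X) / 2`. -/
def plusPart {n : Type*} (R : Matrix n n ℂ →ₗ[ℂ] Matrix n n ℂ) (X : Matrix n n ℂ) :
    Matrix n n ℂ := (1 / 2 : ℂ) • (R X + X)

/-- The component `X₋ = (R X - X) / 2`, so that `X = X₊ - X₋`. -/
def minusPart {n : Type*} (R : Matrix n n ℂ →ₗ[ℂ] Matrix n n ℂ) (X : Matrix n n ℂ) :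
    Matrix n n ℂ := (1 / 2 : ℂ) • (R X - X)

/-- The dual group `G_R` inside the double `GL(n, ℂ) × GL(n, ℂ)`: the connected Lie subgroup with
Lie algebra `{(X₊, X₋) | X ∈ gl(n, ℂ)}`, that is, the subgroup generated by the
exponentials of the elements of this Lie algebra. -/
def dualGroup {n : Type*} [Fintype n] [DecidableEq n]
    (R : Matrix n n ℂ →ₗ[ℂ] Matrix n n ℂ) :
    Subgroup (Matrix.GeneralLinearGroup n ℂ × Matrix.GeneralLinearGroup n ℂ) :=
  Subgroup.closure {p | ∃ X : Matrix n n ℂ,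
    (p.1 : Matrix n n ℂ) = NormedSpace.exp (plusPart R X) ∧
    (p.2 : Matrix n n ℂ) = NormedSpace.exp (minusPart R X)}

/-- `(gp, gm)` is a holomorphic branch on the open set `U` of the momentum map
`(v, wᵀ) ↦ lam + v wᵀ`, regarded as a map to `G_R` through the identification
`(g₊, g₋) ↦ g₊ g₋⁻¹`. -/
structure IsFactorBranch {n d : Type*} [Fintype n] [DecidableEq n] [Fintype d]
    (R : Matrix n n ℂ →ₗ[ℂ] Matrix n n ℂ) (lam : ℂ) (U : Set (Pairs n d))
    (gp gm : Pairs n d → Matrix.GeneralLinearGroup n ℂ) : Prop where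
  isOpen : IsOpen U
  mem : ∀ m ∈ U, (gp m, gm m) ∈ dualGroup R
  factor : ∀ m ∈ U, ((gp m * (gm m)⁻¹ : Matrix.GeneralLinearGroup n ℂ) : Matrix n n ℂ) =
    lam • (1 : Matrix n n ℂ) + m.1 * m.2
  /-- `m ↦ (gp m, gm m)` is holomorphic as a map into the Lie group `G_R`, whose charts around
  the element `(gp m₀, gm m₀)` are `X ↦ (exp X₊, exp X₋) (gp m₀, gm m₀)`. -/
  holomorphic : ∀ m₀ ∈ U, ∃ X : Pairs n d → Matrix n n ℂ,
    AnalyticAt ℂ X m₀ ∧ X m₀ = 0 ∧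
    ∀ᶠ m in 𝓝 m₀,
      (gp m : Matrix n n ℂ) = NormedSpace.exp (plusPart R (X m)) * (gp m₀ : Matrix n n ℂ) ∧
      (gm m : Matrix n n ℂ) = NormedSpace.exp (minusPart R (X m)) * (gm m₀ : Matrix n n ℂ)

/-- The matrix `xᵀ = δ_v F` determined by `dF (a, 0) = tr (xᵀ a)`. -/
def gradV {n d : Type*} [Fintype n] [Fintype d] [DecidableEq n] [DecidableEq d]
    (F : Pairs n d → ℂ) (m : Pairs n d) : Matrix d n ℂ :=
  Matrix.of fun j i => fderiv ℂ F m (Matrix.single i j 1, 0)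

/-- The matrix `ξ = δ_{wᵀ} F` determined by `dF (0, b) = tr (b ξ)`. -/
def gradW {n d : Type*} [Fintype n] [Fintype d] [DecidableEq n] [DecidableEq d]
    (F : Pairs n d → ℂ) (m : Pairs n d) : Matrix n d ℂ :=
  Matrix.of fun i j => fderiv ℂ F m (0, Matrix.single j i 1)

/-- The bivector, at the point `(v, wᵀ)`, applied to the covectors `(ξ, xᵀ)` and `(η, yᵀ)`;
below `w`, `x`, `y` stand for the transposed matrices `wᵀ`, `xᵀ`, `yᵀ`. -/
def bivector {n d : Type*} [Fintype n] [Fintype d]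
    (R : Matrix n n ℂ →ₗ[ℂ] Matrix n n ℂ) (ρ : Matrix d d ℂ →ₗ[ℂ] Matrix d d ℂ) (lam : ℂ)
    (v : Matrix n d ℂ) (w : Matrix d n ℂ)
    (x : Matrix d n ℂ) (ξ : Matrix n d ℂ) (y : Matrix d n ℂ) (η : Matrix n d ℂ) : ℂ :=
  (1 / 2 : ℂ) *
    (-((v * x - ξ * w) * R (v * y - η * w)).trace
      - ((x * v - w * ξ) * ρ (y * v - w * η)).trace
      + (w * v * (x * η - y * ξ)).trace
      + (v * w * (η * x - ξ * y)).trace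
      + 2 * lam * (x * η - y * ξ).trace)

/-- The bracket of two functions on pairs `(v, wᵀ)` defined by `R`, `ρ` and `lam`. -/
def bracket {n d : Type*} [Fintype n] [Fintype d] [DecidableEq n] [DecidableEq d]
    (R : Matrix n n ℂ →ₗ[ℂ] Matrix n n ℂ) (ρ : Matrix d d ℂ →ₗ[ℂ] Matrix d d ℂ) (lam : ℂ)
    (F H : Pairs n d → ℂ) (m : Pairs n d) : ℂ :=
  bivector R ρ lam m.1 m.2 (gradV F m) (gradW F m) (gradV H m) (gradW H m)

/-- The direct sum of two brackets, on functions on the product space. -/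
def prodBracket {E E' : Type*} (B : (E → ℂ) → (E → ℂ) → E → ℂ)
    (B' : (E' → ℂ) → (E' → ℂ) → E' → ℂ) (F H : E × E' → ℂ) (p : E × E') : ℂ :=
  B (fun m => F (m, p.2)) (fun m => H (m, p.2)) p.1 +
    B' (fun q => F (p.1, q)) (fun q => H (p.1, q)) p.2

/-- A holomorphic Poisson bracket on a complex vector space, in terms of germs of holomorphic
functions. -/
structure IsPoissonBracket {E : Type*} [NormedAddCommGroup E] [NormedSpace ℂ E]
    (B : (E → ℂ) → (E → ℂ) → E → ℂ) : Prop where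
  analytic : ∀ F H : E → ℂ, ∀ p, AnalyticAt ℂ F p → AnalyticAt ℂ H p → AnalyticAt ℂ (B F H) p
  congr : ∀ F F' H : E → ℂ, ∀ p, F =ᶠ[𝓝 p] F' → B F H p = B F' H p
  skew : ∀ F H : E → ℂ, ∀ p, AnalyticAt ℂ F p → AnalyticAt ℂ H p → B F H p = -B H F p
  linear : ∀ (a b : ℂ) (F G H : E → ℂ), ∀ p, AnalyticAt ℂ F p → AnalyticAt ℂ G p →
    AnalyticAt ℂ H p → B (a • F + b • G) H p = a * B F H p + b * B G H p
  leibniz : ∀ F G H : E → ℂ, ∀ p, AnalyticAt ℂ F p → AnalyticAt ℂ G p → AnalyticAt ℂ H p →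
    B (F * G) H p = F p * B G H p + B F H p * G p
  jacobi : ∀ F G H : E → ℂ, ∀ p, AnalyticAt ℂ F p → AnalyticAt ℂ G p → AnalyticAt ℂ H p →
    B F (B G H) p + B G (B H F) p + B H (B F G) p = 0

/-- `T` is a Poisson isomorphism of the open set `s` onto an open set: it is biholomorphic onto
its image, and it carries the bracket `B` to the bracket `B'`. -/
structure IsPoissonIsoOn {E E' : Type*} [NormedAddCommGroup E] [NormedSpace ℂ E]
    [NormedAddCommGroup E'] [NormedSpace ℂ E']
    (B : (E → ℂ) → (E → ℂ) → E → ℂ) (B' : (E' → ℂ) → (E' → ℂ) → E' → ℂ)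
    (T : E → E') (s : Set E) : Prop where
  isOpen_source : IsOpen s
  isOpen_image : IsOpen (T '' s)
  analytic : AnalyticOnNhd ℂ T s
  inverse : ∃ S : E' → E, AnalyticOnNhd ℂ S (T '' s) ∧ ∀ p ∈ s, S (T p) = p
  bracket_comp : ∀ p ∈ s, ∀ F H : E' → ℂ, AnalyticAt ℂ F (T p) → AnalyticAt ℂ H (T p) →
    B (F ∘ T) (H ∘ T) p = B' F H (T p)

/-- The semidirect map `Σ (v, wᵀ; V, Wᵀ) = (v, wᵀ; g₊ V, Wᵀ g₋⁻¹)`, where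
`(g₊, g₋) = (gp (v, wᵀ), gm (v, wᵀ))`. -/
def semidirectMap {n d₁ d₂ : Type*} [Fintype n] [DecidableEq n]
    (gp gm : Pairs n d₁ → Matrix.GeneralLinearGroup n ℂ) (p : Pairs n d₁ × Pairs n d₂) :
    Pairs n d₁ × Pairs n d₂ :=
  (p.1, ((gp p.1 : Matrix n n ℂ) * p.2.1,
    p.2.2 * (((gm p.1)⁻¹ : Matrix.GeneralLinearGroup n ℂ) : Matrix n n ℂ)))

/-- Concatenation `(v, wᵀ; V, Wᵀ) ↦ ((v, V), (w, W)ᵀ)`. -/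
def concat {n d₁ d₂ : Type*} (p : Pairs n d₁ × Pairs n d₂) : Pairs n (d₁ ⊕ d₂) :=
  (Matrix.fromCols p.1.1 p.2.1, Matrix.fromRows p.1.2 p.2.2)

/-- The block map acting as `ρ₁`, `ρ₂` on the diagonal blocks, as `+1` on the upper-right block
and as `-1` on the lower-left block. -/
def blockR {d₁ d₂ : Type*} (ρ₁ : Matrix d₁ d₁ ℂ →ₗ[ℂ] Matrix d₁ d₁ ℂ)
    (ρ₂ : Matrix d₂ d₂ ℂ →ₗ[ℂ] Matrix d₂ d₂ ℂ) :
    Matrix (d₁ ⊕ d₂) (d₁ ⊕ d₂) ℂ →ₗ[ℂ] Matrix (d₁ ⊕ d₂) (d₁ ⊕ d₂) ℂ where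
  toFun A := Matrix.fromBlocks (ρ₁ A.toBlocks₁₁) A.toBlocks₁₂ (-A.toBlocks₂₁) (ρ₂ A.toBlocks₂₂)
  map_add' A B := by
    have h₁ : (A + B).toBlocks₁₁ = A.toBlocks₁₁ + B.toBlocks₁₁ := rfl
    have h₂ : (A + B).toBlocks₂₂ = A.toBlocks₂₂ + B.toBlocks₂₂ := rfl
    have h₃ : (A + B).toBlocks₁₂ = A.toBlocks₁₂ + B.toBlocks₁₂ := rfl
    have h₄ : (A + B).toBlocks₂₁ = A.toBlocks₂₁ + B.toBlocks₂₁ := rfl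
    rw [h₁, h₂, h₃, h₄, map_add, map_add, neg_add, Matrix.fromBlocks_add]
  map_smul' c A := by
    have h₁ : (c • A).toBlocks₁₁ = c • A.toBlocks₁₁ := rfl
    have h₂ : (c • A).toBlocks₂₂ = c • A.toBlocks₂₂ := rfl
    have h₃ : (c • A).toBlocks₁₂ = c • A.toBlocks₁₂ := rfl
    have h₄ : (c • A).toBlocks₂₁ = c • A.toBlocks₂₁ := rfl
    rw [h₁, h₂, h₃, h₄, map_smul, map_smul, ← smul_neg, RingHom.id_apply,
      Matrix.fromBlocks_smul]

end SemidirectPB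

end

/-!
Everything happens in the block algebra of size `n + d`. A point `(v, wᵀ)` is an off-diagonal
matrix `Z`, a covector `(ξ, xᵀ)` is an off-diagonal matrix `X`, and the two matrices `v xᵀ - ξ wᵀ`
and `xᵀ v - wᵀ ξ` are, up to sign, the diagonal blocks of `[Z, X]`. With `𝓡 = (R, ρ)` acting on
block-diagonal matrices and `γ = diag (1, -1)`, twice the bracket is
`- tr ([Z, X] 𝓡 [Z, Y]) - tr (γ (Z² + lam) [X, Y])` (`bivector_eq_offDiag`). The second derivatives
in the Jacobi identity cancel by symmetry (`bracket_bracket`). What is left is an identity between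
traces of words in `Z`, the three covectors and the matrices `𝓡 [Z, X]` (`jacobi_of_tracial`): the
part quadratic in `𝓡` reduces by the Yang-Baxter equation to a word free of `𝓡`, which the second
summand of the bracket cancels. That the block map is an r-matrix is a computation with blocks.

For the isomorphism put `L = lam + v wᵀ = g₊ g₋⁻¹`. Differentiating this equation in the charts of
the dual group gives `δL = X₊ L - L X₋`, where `δg₊ = X₊ g₊` and `δg₋ = X₋ g₋`. The pullback of a
covector `(ξ₂, x₂)` of the second factor thus adds `tr (X₊ A) - tr (X₋ B)` to the covector of the
first one, where `A = g₊ V x₂` and `B = ξ₂ Wᵀ g₋⁻¹`. The Lie algebra of the dual group is isotropic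
in the double, so this is `tr (δL N)` whenever `(L N, N L) - (A, B)` lies in it. By invariance of
this Lie algebra under the adjoint action of the group (`IsRMatrix.adjoint_mem`), such an `N` is
obtained from the diagonal component of `(g₊⁻¹ A g₊, g₋⁻¹ B g₋)` (`momentumCovector_spec`). The
Hamiltonian vector of `tr (δL N)` is `(-K v, wᵀ K)` with `K = B₊ - A₋` (`hamVec_momentum`), and
the brackets can be compared term by term (`bivector_semidirect`); the constant `1` in the second
bracket is what produces `L`, hence `lam` and the mixed blocks, out of `g₊ g₋⁻¹`.
-/

noncomputable section

namespace SemidirectPB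

/-! ### The block r-matrix and the Yang-Baxter equation -/

theorem trace_fromBlocks {m n : Type*} [Fintype m] [Fintype n] (A : Matrix m m ℂ)
    (B : Matrix m n ℂ) (C : Matrix n m ℂ) (D : Matrix n n ℂ) :
    (Matrix.fromBlocks A B C D).trace = A.trace + D.trace := by
  simp [Matrix.trace]

theorem blockR_fromBlocks {d₁ d₂ : Type*} (ρ₁ : Matrix d₁ d₁ ℂ →ₗ[ℂ] Matrix d₁ d₁ ℂ)
    (ρ₂ : Matrix d₂ d₂ ℂ →ₗ[ℂ] Matrix d₂ d₂ ℂ) (A : Matrix d₁ d₁ ℂ) (B : Matrix d₁ d₂ ℂ)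
    (C : Matrix d₂ d₁ ℂ) (D : Matrix d₂ d₂ ℂ) :
    blockR ρ₁ ρ₂ (Matrix.fromBlocks A B C D) = Matrix.fromBlocks (ρ₁ A) B (-C) (ρ₂ D) := rfl

theorem IsRMatrix.blockR {d₁ d₂ : Type*} [Fintype d₁] [Fintype d₂] [DecidableEq d₁]
    [DecidableEq d₂] {ρ₁ : Matrix d₁ d₁ ℂ →ₗ[ℂ] Matrix d₁ d₁ ℂ}
    {ρ₂ : Matrix d₂ d₂ ℂ →ₗ[ℂ] Matrix d₂ d₂ ℂ} (h₁ : IsRMatrix ρ₁) (h₂ : IsRMatrix ρ₂) :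
    IsRMatrix (blockR ρ₁ ρ₂) where
  skew X Y := by
    rw [← Matrix.fromBlocks_toBlocks X, ← Matrix.fromBlocks_toBlocks Y]
    simp only [blockR_fromBlocks, Matrix.fromBlocks_multiply, trace_fromBlocks,
      Matrix.trace_add, h₁.skew, h₂.skew, Matrix.neg_mul, Matrix.mul_neg, Matrix.trace_neg]
    ring
  yangBaxter X Y := by
    rw [← Matrix.fromBlocks_toBlocks X, ← Matrix.fromBlocks_toBlocks Y]
    generalize X.toBlocks₁₁ = A
    generalize X.toBlocks₁₂ = B
    generalize X.toBlocks₂₁ = C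
    generalize X.toBlocks₂₂ = D
    generalize Y.toBlocks₁₁ = A'
    generalize Y.toBlocks₁₂ = B'
    generalize Y.toBlocks₂₁ = C'
    generalize Y.toBlocks₂₂ = D'
    have e₁ := h₁.yangBaxter A A'
    have e₂ := h₂.yangBaxter D D'
    rw [sub_add_eq_add_sub, sub_eq_zero] at e₁ e₂
    simp only [Ring.lie_def, blockR_fromBlocks, Matrix.fromBlocks_multiply, sub_eq_add_neg,
      Matrix.fromBlocks_neg, Matrix.fromBlocks_add, Matrix.neg_mul, Matrix.mul_neg] at e₁ e₂ ⊢
    rw [← Matrix.fromBlocks_zero, Matrix.fromBlocks_inj]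
    refine ⟨?_, ?_, ?_, ?_⟩
    · have : ρ₁ A * A' + B * C' + -(A' * ρ₁ A + -(B' * C)) +
          (A * ρ₁ A' + -(B * C') + -(ρ₁ A' * A + B' * C)) =
          ρ₁ A * A' + -(A' * ρ₁ A) + (A * ρ₁ A' + -(ρ₁ A' * A)) := by abel
      rw [this, ← e₁]; abel
    · abel
    · abel
    · have : -(C * B') + ρ₂ D * D' + -(C' * B + D' * ρ₂ D) +
          (C * B' + D * ρ₂ D' + -(-(C' * B) + ρ₂ D' * D)) =
          ρ₂ D * D' + -(D' * ρ₂ D) + (D * ρ₂ D' + -(ρ₂ D' * D)) := by abel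
      rw [this, ← e₂]; abel

/-- The Yang-Baxter equation paired with a third matrix. Skew-symmetry gives it this cyclic form. -/
theorem IsRMatrix.trace_yangBaxter {n : Type*} [Fintype n] [DecidableEq n]
    {R : Matrix n n ℂ →ₗ[ℂ] Matrix n n ℂ} (h : IsRMatrix R) (A B C : Matrix n n ℂ) :
    (A * ⁅R B, R C⁆).trace + (B * ⁅R C, R A⁆).trace + (C * ⁅R A, R B⁆).trace
      + (A * ⁅B, C⁆).trace = 0 := by
  have yb := congrArg (fun M => (A * M).trace) (h.yangBaxter B C)
  have e := h.skew A (⁅R B, C⁆ + ⁅B, R C⁆)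
  have c₁ := Matrix.trace_mul_comm (R A * R B) C
  have c₂ := Matrix.trace_mul_comm (R A) (C * R B)
  have c₃ := Matrix.trace_mul_comm (R A) (B * R C)
  have c₄ := Matrix.trace_mul_comm (R A * R C) B
  simp only [Ring.lie_def, Matrix.mul_add, Matrix.mul_sub, Matrix.trace_add, Matrix.trace_sub,
    Matrix.mul_zero, Matrix.trace_zero, map_add, Matrix.mul_assoc] at yb e c₁ c₂ c₃ c₄ ⊢
  linear_combination yb + e - c₁ + c₂ - c₃ + c₄

/-- Algebraic core of the Jacobi identity, in any algebra with a trace. Here `Z` is the point, `X`,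
`Y`, `W` are covectors, `r`, `s`, `t` stand for the values of the r-matrix on their commutators with
`Z`, and `U₁`, `U₂`, `U₃` are twice the Hamiltonian vectors. The terms of each degree in `r`, `s`,
`t` are collected separately; those of degree two reduce by the Yang-Baxter equation to a term of
degree zero. -/
theorem jacobi_of_tracial {𝒜 : Type*} [Ring 𝒜] [Algebra ℂ 𝒜] (τ : 𝒜 →ₗ[ℂ] ℂ)
    (hτ : ∀ a b, τ (a * b) = τ (b * a)) (lam : ℂ) (γ Z X Y W r s t : 𝒜)
    (hγ : γ * γ = 1) (hZ : Z * γ = -(γ * Z)) (hX : X * γ = -(γ * X)) (hY : Y * γ = -(γ * Y))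
    (hW : W * γ = -(γ * W)) (hr : r * γ = γ * r) (hs : s * γ = γ * s) (ht : t * γ = γ * t)
    (yb : τ (⁅Z, X⁆ * ⁅s, t⁆) + τ (⁅Z, Y⁆ * ⁅t, r⁆) + τ (⁅Z, W⁆ * ⁅r, s⁆)
      + τ (⁅Z, X⁆ * ⁅⁅Z, Y⁆, ⁅Z, W⁆⁆) = 0)
    (U₁ U₂ U₃ : 𝒜)
    (hU₁ : U₁ = ⁅r, Z⁆ - γ * (Z * Z * X + X * (Z * Z) + (2 * lam) • X))
    (hU₂ : U₂ = ⁅s, Z⁆ - γ * (Z * Z * Y + Y * (Z * Z) + (2 * lam) • Y))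
    (hU₃ : U₃ = ⁅t, Z⁆ - γ * (Z * Z * W + W * (Z * Z) + (2 * lam) • W)) :
    (-τ (⁅U₁, Y⁆ * t) + τ (s * ⁅U₁, W⁆) - τ (γ * (U₁ * Z + Z * U₁) * ⁅Y, W⁆)) +
    (-τ (⁅U₂, W⁆ * r) + τ (t * ⁅U₂, X⁆) - τ (γ * (U₂ * Z + Z * U₂) * ⁅W, X⁆)) +
    (-τ (⁅U₃, X⁆ * s) + τ (r * ⁅U₃, Y⁆) - τ (γ * (U₃ * Z + Z * U₃) * ⁅X, Y⁆)) = 0 := by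
  have inv (a b c : 𝒜) : τ (a * ⁅b, c⁆) = τ (⁅a, b⁆ * c) := by
    have := hτ (a * c) b
    simp only [Ring.lie_def, mul_sub, sub_mul, map_sub, mul_assoc] at this ⊢
    rw [this]
  have skew (a b : 𝒜) : ⁅a, b⁆ = -⁅b, a⁆ := by simp only [Ring.lie_def, neg_sub]
  have lie_sub_left (a b c : 𝒜) : ⁅a - b, c⁆ = ⁅a, c⁆ - ⁅b, c⁆ := by
    simp only [Ring.lie_def]
    noncomm_ring
  have hZZ : Z * Z * γ = γ * (Z * Z) := by
    rw [mul_assoc, hZ, mul_neg, ← mul_assoc, hZ, neg_mul, neg_neg, mul_assoc]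
  set T : 𝒜 → 𝒜 := fun X => Z * Z * X + X * (Z * Z) + (2 * lam) • X with hT
  -- terms of first degree in `r`, `s`, `t`
  have lin (X Y t : 𝒜) (hX : X * γ = -(γ * X)) (hY : Y * γ = -(γ * Y)) (ht : t * γ = γ * t) :
      τ (t * ⁅γ * T X, Y⁆) - τ (t * ⁅γ * T Y, X⁆) = τ (γ * ⁅t, Z * Z⁆ * ⁅X, Y⁆) := by
    have e : ⁅γ * T X, Y⁆ - ⁅γ * T Y, X⁆ = γ * ⁅Z * Z, ⁅X, Y⁆⁆ := by
      have e₁ : Y * (γ * T X) = -(γ * (Y * T X)) := by rw [← mul_assoc, hY]; noncomm_ring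
      have e₂ : X * (γ * T Y) = -(γ * (X * T Y)) := by rw [← mul_assoc, hX]; noncomm_ring
      simp only [Ring.lie_def, e₁, e₂]
      simp only [hT]
      simp only [mul_add, add_mul, mul_sub, sub_mul, mul_assoc, mul_smul_comm, smul_mul_assoc]
      abel
    have e' : γ * ⁅t, Z * Z⁆ = ⁅γ * t, Z * Z⁆ := by
      simp only [Ring.lie_def, mul_sub, ← mul_assoc, hZZ]
    rw [← map_sub, ← mul_sub, e, e', ← mul_assoc, ht, inv]
  -- terms of second degree in `r`, `s`, `t`
  have quad (X s t : 𝒜) :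
      τ (t * ⁅⁅s, Z⁆, X⁆) - τ (s * ⁅⁅t, Z⁆, X⁆) = -τ (⁅Z, X⁆ * ⁅s, t⁆) := by
    rw [hτ ⁅Z, X⁆, inv, inv, inv, ← map_sub, ← sub_mul, ← map_neg, ← neg_mul]
    congr 2
    simp only [Ring.lie_def]
    noncomm_ring
  have cubic : τ (⁅T X, Z⁆ * ⁅Y, W⁆) + τ (⁅T Y, Z⁆ * ⁅W, X⁆) + τ (⁅T W, Z⁆ * ⁅X, Y⁆) =
      -τ (⁅Z, X⁆ * ⁅⁅Z, Y⁆, ⁅Z, W⁆⁆) := by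
    have c₁ : τ (⁅T X, Z⁆ * ⁅Y, W⁆) = -τ ((⁅⁅Y, W⁆, Z⁆ * (Z * Z) + Z * Z * ⁅⁅Y, W⁆, Z⁆ +
        (2 * lam) • ⁅⁅Y, W⁆, Z⁆) * X) := by
      have := hτ (⁅⁅Y, W⁆, Z⁆ * X) (Z * Z)
      rw [hτ, skew (T X), mul_neg, map_neg, inv, hT]
      simp only [mul_add, add_mul, map_add, mul_smul_comm, smul_mul_assoc, mul_assoc] at this ⊢
      rw [this]
    have c₂ : τ (⁅T W, Z⁆ * ⁅X, Y⁆) = -τ (⁅⁅T W, Z⁆, Y⁆ * X) := by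
      rw [skew X, mul_neg, map_neg, inv]
    rw [c₁, c₂, inv, hτ ⁅Z, X⁆, inv, ← map_neg, ← map_neg, ← map_neg, ← map_add, ← map_add,
      ← neg_mul, ← neg_mul, ← neg_mul, ← add_mul, ← add_mul]
    congr 2
    simp only [Ring.lie_def, hT]
    simp only [mul_add, add_mul, mul_sub, sub_mul, mul_assoc, mul_smul_comm, smul_mul_assoc,
      smul_sub]
    abel
  have mov (r X K : 𝒜) (hr : r * γ = γ * r) (U : 𝒜) (hU : U = ⁅r, Z⁆ - γ * T X) :
      τ (γ * (U * Z + Z * U) * K) = τ (γ * ⁅r, Z * Z⁆ * K) - τ (⁅T X, Z⁆ * K) := by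
    have e : γ * (U * Z + Z * U) = γ * ⁅r, Z * Z⁆ - ⁅T X, Z⁆ := by
      have e₁ : γ * (Z * (γ * T X)) = -(Z * T X) := by
        rw [← mul_assoc Z, hZ, neg_mul, mul_neg, ← mul_assoc, ← mul_assoc, hγ, one_mul]
      have e₂ : γ * (γ * T X * Z) = T X * Z := by
        rw [← mul_assoc, ← mul_assoc, hγ, one_mul]
      rw [hU, sub_mul, mul_sub, add_sub_assoc', mul_sub, e₁, sub_add_eq_add_sub, mul_sub, e₂]
      simp only [Ring.lie_def]
      noncomm_ring
    rw [e, sub_mul, map_sub]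
  rw [hτ ⁅U₁, Y⁆, hτ ⁅U₂, W⁆, hτ ⁅U₃, X⁆, mov r X _ hr U₁ hU₁, mov s Y _ hs U₂ hU₂,
    mov t W _ ht U₃ hU₃, hU₁, hU₂, hU₃]
  simp only [lie_sub_left, mul_sub, map_sub]
  linear_combination lin X Y t hX hY ht + lin Y W r hY hW hr + lin W X s hW hX hs +
    quad X s t + quad Y t r + quad W r s + cubic - yb

/-! ### The bracket in the block algebra, and the Jacobi identity -/

section
variable {n d : Type*}

theorem fromBlocks_sub (A A' : Matrix n n ℂ) (B B' : Matrix n d ℂ) (C C' : Matrix d n ℂ)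
    (D D' : Matrix d d ℂ) : Matrix.fromBlocks A B C D - Matrix.fromBlocks A' B' C' D' =
      Matrix.fromBlocks (A - A') (B - B') (C - C') (D - D') := by
  simp [sub_eq_add_neg, Matrix.fromBlocks_neg, Matrix.fromBlocks_add]

/-- The pair `(v, wᵀ)` as the off-diagonal element of the block algebra. -/
def offDiag : Pairs n d →ₗ[ℂ] Matrix (n ⊕ d) (n ⊕ d) ℂ where
  toFun p := Matrix.fromBlocks 0 p.1 p.2 0
  map_add' p q := by simp [Matrix.fromBlocks_add]
  map_smul' c p := by simp [Matrix.fromBlocks_smul]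

/-- The endomorphism of the block algebra which acts as `R` and `ρ` on the diagonal blocks, and as
zero on the off-diagonal ones. -/
def diagR (R : Matrix n n ℂ →ₗ[ℂ] Matrix n n ℂ) (ρ : Matrix d d ℂ →ₗ[ℂ] Matrix d d ℂ) :
    Matrix (n ⊕ d) (n ⊕ d) ℂ →ₗ[ℂ] Matrix (n ⊕ d) (n ⊕ d) ℂ where
  toFun A := Matrix.fromBlocks (R A.toBlocks₁₁) 0 0 (ρ A.toBlocks₂₂)
  map_add' A B := by
    have h₁ : (A + B).toBlocks₁₁ = A.toBlocks₁₁ + B.toBlocks₁₁ := rfl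
    have h₂ : (A + B).toBlocks₂₂ = A.toBlocks₂₂ + B.toBlocks₂₂ := rfl
    simp [h₁, h₂, Matrix.fromBlocks_add]
  map_smul' c A := by
    have h₁ : (c • A).toBlocks₁₁ = c • A.toBlocks₁₁ := rfl
    have h₂ : (c • A).toBlocks₂₂ = c • A.toBlocks₂₂ := rfl
    simp [h₁, h₂, Matrix.fromBlocks_smul]

/-- The grading operator of the block algebra. -/
def parity [DecidableEq n] [DecidableEq d] : Matrix (n ⊕ d) (n ⊕ d) ℂ :=
  Matrix.fromBlocks 1 0 0 (-1)

/-- The coefficients `(ξ, xᵀ)` of the covector `(a, b) ↦ tr (xᵀ a) + tr (b ξ)`. -/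
def gradOf [Fintype n] [Fintype d] [DecidableEq n] [DecidableEq d] :
    (Pairs n d →L[ℂ] ℂ) →ₗ[ℂ] Pairs n d where
  toFun D := (Matrix.of fun i j => D (0, Matrix.single j i 1),
    Matrix.of fun j i => D (Matrix.single i j 1, 0))
  map_add' D D' := by ext <;> simp
  map_smul' c D := by ext <;> simp

theorem offDiag_apply (p : Pairs n d) : offDiag p = Matrix.fromBlocks 0 p.1 p.2 0 := rfl

theorem diagR_fromBlocks (R : Matrix n n ℂ →ₗ[ℂ] Matrix n n ℂ)
    (ρ : Matrix d d ℂ →ₗ[ℂ] Matrix d d ℂ) (A : Matrix n n ℂ) (B : Matrix n d ℂ)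
    (C : Matrix d n ℂ) (D : Matrix d d ℂ) :
    diagR R ρ (Matrix.fromBlocks A B C D) = Matrix.fromBlocks (R A) 0 0 (ρ D) := rfl

theorem trace_offDiag_mul [Fintype n] [Fintype d] (p q : Pairs n d) :
    (offDiag p * offDiag q).trace = (p.1 * q.2).trace + (p.2 * q.1).trace := by
  simp [offDiag_apply, Matrix.fromBlocks_multiply, trace_fromBlocks]

variable [Fintype n] [Fintype d] [DecidableEq n] [DecidableEq d]

theorem apply_eq_trace (D : Pairs n d →L[ℂ] ℂ) (u : Pairs n d) :
    D u = (offDiag u * offDiag (gradOf D)).trace := by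
  rw [trace_offDiag_mul]
  have h : u = (u.1, 0) + (0, u.2) := by simp
  have h₁ : ((u.1, 0) : Pairs n d) = ∑ i, ∑ j, u.1 i j • (Matrix.single i j 1, 0) := by
    conv_lhs => rw [Matrix.matrix_eq_sum_single u.1]
    ext <;> simp [Prod.fst_sum, Prod.snd_sum, Matrix.sum_apply]
  have h₂ : ((0, u.2) : Pairs n d) = ∑ j, ∑ i, u.2 j i • (0, Matrix.single j i 1) := by
    conv_lhs => rw [Matrix.matrix_eq_sum_single u.2]
    ext <;> simp [Prod.fst_sum, Prod.snd_sum, Matrix.sum_apply]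
  conv_lhs => rw [h, map_add, h₁, h₂]
  simp only [map_sum, map_smul, smul_eq_mul]
  simp [gradOf, Matrix.trace, Matrix.mul_apply]

/-- The trace pairing of covectors with vectors is perfect. -/
theorem gradOf_eq (D : Pairs n d →L[ℂ] ℂ) (g : Pairs n d)
    (h : ∀ u, D u = (u.1 * g.2).trace + (u.2 * g.1).trace) : gradOf D = g := by
  ext i j <;> simp [gradOf, h, Matrix.trace_single_mul]

theorem bracket_eq_gradOf (R : Matrix n n ℂ →ₗ[ℂ] Matrix n n ℂ)
    (ρ : Matrix d d ℂ →ₗ[ℂ] Matrix d d ℂ) (lam : ℂ) (F H : Pairs n d → ℂ) (p : Pairs n d) :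
    bracket R ρ lam F H p = bivector R ρ lam p.1 p.2 (gradOf (fderiv ℂ F p)).2
      (gradOf (fderiv ℂ F p)).1 (gradOf (fderiv ℂ H p)).2 (gradOf (fderiv ℂ H p)).1 := rfl

theorem offDiag_mul (p q : Pairs n d) :
    offDiag p * offDiag q = Matrix.fromBlocks (p.1 * q.2) 0 0 (p.2 * q.1) := by
  simp [offDiag_apply, Matrix.fromBlocks_multiply]

theorem lie_offDiag (p g : Pairs n d) : ⁅offDiag p, offDiag g⁆ =
    Matrix.fromBlocks (p.1 * g.2 - g.1 * p.2) 0 0 (-(g.2 * p.1 - p.2 * g.1)) := by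
  simp [Ring.lie_def, offDiag_mul, fromBlocks_sub]

theorem diagR_lie_offDiag (R : Matrix n n ℂ →ₗ[ℂ] Matrix n n ℂ)
    (ρ : Matrix d d ℂ →ₗ[ℂ] Matrix d d ℂ) (p g : Pairs n d) :
    diagR R ρ ⁅offDiag p, offDiag g⁆ =
      Matrix.fromBlocks (R (p.1 * g.2 - g.1 * p.2)) 0 0 (-ρ (g.2 * p.1 - p.2 * g.1)) := by
  rw [lie_offDiag, diagR_fromBlocks, map_neg]

/-- The bivector in terms of the block algebra, where the two momentum maps `v xᵀ - ξ wᵀ` and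
`xᵀ v - wᵀ ξ` are the diagonal blocks of one commutator. -/
theorem bivector_eq_offDiag (R : Matrix n n ℂ →ₗ[ℂ] Matrix n n ℂ)
    (ρ : Matrix d d ℂ →ₗ[ℂ] Matrix d d ℂ) (lam : ℂ) (p g h : Pairs n d) :
    bivector R ρ lam p.1 p.2 g.2 g.1 h.2 h.1 = (1 / 2 : ℂ) *
      (-(⁅offDiag p, offDiag g⁆ * diagR R ρ ⁅offDiag p, offDiag h⁆).trace
        - (parity * (offDiag p * offDiag p + lam • 1) * ⁅offDiag g, offDiag h⁆).trace) := by
  have c₁ : (h.1 * g.2).trace = (g.2 * h.1).trace := Matrix.trace_mul_comm _ _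
  have c₂ : (g.1 * h.2).trace = (h.2 * g.1).trace := Matrix.trace_mul_comm _ _
  rw [diagR_lie_offDiag, lie_offDiag, lie_offDiag, ← Matrix.fromBlocks_one]
  simp only [offDiag_mul, parity, Matrix.fromBlocks_multiply, bivector, Matrix.fromBlocks_add,
    Matrix.fromBlocks_smul, trace_fromBlocks]
  simp only [Matrix.mul_zero, Matrix.zero_mul, add_zero, zero_add, Matrix.neg_mul, Matrix.mul_neg,
    neg_neg, Matrix.one_mul, smul_zero, Matrix.add_mul, Matrix.smul_mul, Matrix.trace_add,
    Matrix.trace_neg, Matrix.trace_smul, smul_eq_mul, neg_add, Matrix.trace_sub, c₁, c₂,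
    Matrix.mul_sub]
  ring

/-- The vector obtained by contracting the bivector at `p` with the covector `g = (ξ, xᵀ)`. -/
def hamVec (R : Matrix n n ℂ →ₗ[ℂ] Matrix n n ℂ) (ρ : Matrix d d ℂ →ₗ[ℂ] Matrix d d ℂ) (lam : ℂ)
    (p g : Pairs n d) : Pairs n d :=
  ((1 / 2 : ℂ) • (R (p.1 * g.2 - g.1 * p.2) * p.1 + p.1 * ρ (g.2 * p.1 - p.2 * g.1)
      - (g.1 * p.2 * p.1 + p.1 * p.2 * g.1)) - lam • g.1,
   (1 / 2 : ℂ) • (-(p.2 * R (p.1 * g.2 - g.1 * p.2)) - ρ (g.2 * p.1 - p.2 * g.1) * p.2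
      + (p.2 * p.1 * g.2 + g.2 * p.1 * p.2)) + lam • g.2)

theorem offDiag_hamVec (R : Matrix n n ℂ →ₗ[ℂ] Matrix n n ℂ)
    (ρ : Matrix d d ℂ →ₗ[ℂ] Matrix d d ℂ) (lam : ℂ) (p g : Pairs n d) :
    (2 : ℂ) • offDiag (hamVec R ρ lam p g) =
      ⁅diagR R ρ ⁅offDiag p, offDiag g⁆, offDiag p⁆ - parity * (offDiag p * offDiag p * offDiag g
        + offDiag g * (offDiag p * offDiag p) + (2 * lam) • offDiag g) := by
  rw [diagR_lie_offDiag, Ring.lie_def]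
  simp only [offDiag_apply, parity, Matrix.fromBlocks_multiply, hamVec,
    fromBlocks_sub, Matrix.fromBlocks_add, Matrix.fromBlocks_smul]
  rw [Matrix.fromBlocks_inj]
  have h2 : (2 : ℂ) * (1 / 2) = 1 := by norm_num
  refine ⟨?_, ?_, ?_, ?_⟩ <;>
  simp only [smul_sub, smul_add, smul_smul, Matrix.mul_assoc, Matrix.mul_zero, Matrix.zero_mul,
    Matrix.neg_mul, Matrix.mul_neg, smul_zero, add_zero, zero_add, h2, one_smul, Matrix.one_mul,
    Matrix.mul_add, sub_zero, zero_sub, smul_neg] <;> abel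

theorem bivector_eq_trace_hamVec {R : Matrix n n ℂ →ₗ[ℂ] Matrix n n ℂ}
    {ρ : Matrix d d ℂ →ₗ[ℂ] Matrix d d ℂ} (hR : IsRMatrix R) (hρ : IsRMatrix ρ) (lam : ℂ)
    (p g h : Pairs n d) :
    bivector R ρ lam p.1 p.2 g.2 g.1 h.2 h.1 =
      (offDiag (hamVec R ρ lam p g) * offDiag h).trace := by
  obtain ⟨v, w⟩ := p
  obtain ⟨ξ, x⟩ := g
  obtain ⟨η, y⟩ := h
  rw [trace_offDiag_mul]
  have e₁ := hR.skew (v * x - ξ * w) (v * y - η * w)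
  have e₂ := hρ.skew (x * v - w * ξ) (y * v - w * η)
  simp only [bivector, hamVec]
  generalize v * x - ξ * w = A at *
  generalize x * v - w * ξ = B at *
  rw [← neg_eq_iff_eq_neg] at e₁ e₂
  rw [← e₁, sub_eq_add_neg _ (Matrix.trace (B * _)), ← e₂]
  have c₁ := Matrix.trace_mul_comm v (ρ B * y)
  have c₂ := Matrix.trace_mul_comm w (R A * η)
  have c₃ := Matrix.trace_mul_comm ξ (w * v * y)
  have c₄ := Matrix.trace_mul_comm x (v * w * η)
  have c₅ := Matrix.trace_mul_comm ξ y
  simp only [Matrix.add_mul, Matrix.mul_sub, Matrix.sub_mul, Matrix.trace_add,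
    Matrix.trace_sub, Matrix.mul_assoc, Matrix.neg_mul, Matrix.smul_mul, Matrix.trace_neg,
    Matrix.trace_smul, smul_eq_mul] at c₁ c₂ c₃ c₄ c₅ ⊢
  linear_combination -(1 / 2) * c₁ + (1 / 2) * c₂ + (1 / 2) * c₃ - (1 / 2) * c₄ + lam * c₅


theorem trace_diagR_mul {R : Matrix n n ℂ →ₗ[ℂ] Matrix n n ℂ}
    {ρ : Matrix d d ℂ →ₗ[ℂ] Matrix d d ℂ} (hR : IsRMatrix R) (hρ : IsRMatrix ρ)
    (A B : Matrix (n ⊕ d) (n ⊕ d) ℂ) : (diagR R ρ A * B).trace = -(A * diagR R ρ B).trace := by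
  rw [← Matrix.fromBlocks_toBlocks A, ← Matrix.fromBlocks_toBlocks B]
  simp only [diagR_fromBlocks, Matrix.fromBlocks_multiply, trace_fromBlocks, Matrix.zero_mul,
    Matrix.mul_zero, add_zero, zero_add, hR.skew, hρ.skew]
  ring

/-- Both r-matrices satisfy the Yang-Baxter equation, hence so does `diagR` on the block-diagonal
matrices `[Z, X]` with `Z` and `X` off-diagonal. -/
theorem trace_yangBaxter_offDiag {R : Matrix n n ℂ →ₗ[ℂ] Matrix n n ℂ}
    {ρ : Matrix d d ℂ →ₗ[ℂ] Matrix d d ℂ} (hR : IsRMatrix R) (hρ : IsRMatrix ρ)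
    (p f g h : Pairs n d) :
    (⁅offDiag p, offDiag f⁆ * ⁅diagR R ρ ⁅offDiag p, offDiag g⁆,
      diagR R ρ ⁅offDiag p, offDiag h⁆⁆).trace +
    (⁅offDiag p, offDiag g⁆ * ⁅diagR R ρ ⁅offDiag p, offDiag h⁆,
      diagR R ρ ⁅offDiag p, offDiag f⁆⁆).trace +
    (⁅offDiag p, offDiag h⁆ * ⁅diagR R ρ ⁅offDiag p, offDiag f⁆,
      diagR R ρ ⁅offDiag p, offDiag g⁆⁆).trace +
    (⁅offDiag p, offDiag f⁆ * ⁅⁅offDiag p, offDiag g⁆, ⁅offDiag p, offDiag h⁆⁆).trace = 0 := by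
  have e₁ := hR.trace_yangBaxter (p.1 * f.2 - f.1 * p.2) (p.1 * g.2 - g.1 * p.2)
    (p.1 * h.2 - h.1 * p.2)
  have e₂ := hρ.trace_yangBaxter (-(f.2 * p.1 - p.2 * f.1)) (-(g.2 * p.1 - p.2 * g.1))
    (-(h.2 * p.1 - p.2 * h.1))
  simp only [lie_offDiag, diagR_fromBlocks]
  simp only [Ring.lie_def, Matrix.fromBlocks_multiply, fromBlocks_sub, trace_fromBlocks,
    Matrix.mul_zero, Matrix.zero_mul, add_zero, zero_add, sub_zero] at e₁ e₂ ⊢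
  linear_combination e₁ + e₂

theorem bivector_skew {R : Matrix n n ℂ →ₗ[ℂ] Matrix n n ℂ}
    {ρ : Matrix d d ℂ →ₗ[ℂ] Matrix d d ℂ} (hR : IsRMatrix R) (hρ : IsRMatrix ρ) (lam : ℂ)
    (v : Matrix n d ℂ) (w x : Matrix d n ℂ) (ξ : Matrix n d ℂ) (y : Matrix d n ℂ)
    (η : Matrix n d ℂ) :
    bivector R ρ lam v w x ξ y η = -bivector R ρ lam v w y η x ξ := by
  have e₁ := hR.skew (v * x - ξ * w) (v * y - η * w)
  have e₂ := hρ.skew (x * v - w * ξ) (y * v - w * η)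
  rw [Matrix.trace_mul_comm] at e₁ e₂
  simp only [bivector, Matrix.mul_sub (w * v), Matrix.mul_sub (v * w), Matrix.trace_sub]
  linear_combination -(1 / 2) * e₁ - (1 / 2) * e₂

theorem bracket_eq_fderiv {R : Matrix n n ℂ →ₗ[ℂ] Matrix n n ℂ}
    {ρ : Matrix d d ℂ →ₗ[ℂ] Matrix d d ℂ} (hR : IsRMatrix R) (hρ : IsRMatrix ρ) (lam : ℂ)
    (F H : Pairs n d → ℂ) (p : Pairs n d) : bracket R ρ lam F H p =
      fderiv ℂ H p (hamVec R ρ lam p (gradOf (fderiv ℂ F p))) := by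
  rw [bracket_eq_gradOf, bivector_eq_trace_hamVec hR hρ, apply_eq_trace]

theorem bracket_skew {R : Matrix n n ℂ →ₗ[ℂ] Matrix n n ℂ}
    {ρ : Matrix d d ℂ →ₗ[ℂ] Matrix d d ℂ} (hR : IsRMatrix R) (hρ : IsRMatrix ρ) (lam : ℂ)
    (F H : Pairs n d → ℂ) (p : Pairs n d) :
    bracket R ρ lam F H p = -bracket R ρ lam H F p :=
  bivector_skew hR hρ ..

theorem hasDerivAt_line {E : Type*} [NormedAddCommGroup E] [NormedSpace ℂ E] (p u : E) :
    HasDerivAt (fun t : ℂ => p + t • u) u 0 := by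
  simpa using ((hasDerivAt_id (0 : ℂ)).smul_const u).const_add p

theorem hasDerivAt_linearMap {E E' : Type*} [NormedAddCommGroup E] [NormedSpace ℂ E]
    [NormedAddCommGroup E'] [NormedSpace ℂ E'] [FiniteDimensional ℂ E] (L : E →ₗ[ℂ] E')
    {f : ℂ → E} {f' : E} {t : ℂ} (h : HasDerivAt f f' t) :
    HasDerivAt (fun t => L (f t)) (L f') t :=
  (LinearMap.toContinuousLinearMap L).hasFDerivAt.comp_hasDerivAt t h

theorem analyticAt_linearMap {E E' E'' : Type*} [NormedAddCommGroup E] [NormedSpace ℂ E]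
    [NormedAddCommGroup E'] [NormedSpace ℂ E'] [NormedAddCommGroup E''] [NormedSpace ℂ E'']
    [FiniteDimensional ℂ E] (L : E →ₗ[ℂ] E') {f : E'' → E} {p : E''} (h : AnalyticAt ℂ f p) :
    AnalyticAt ℂ (fun q => L (f q)) p :=
  ((LinearMap.toContinuousLinearMap L).analyticAt (f p)).comp h

theorem analyticAt_bracket (R : Matrix n n ℂ →ₗ[ℂ] Matrix n n ℂ)
    (ρ : Matrix d d ℂ →ₗ[ℂ] Matrix d d ℂ) (lam : ℂ) {F H : Pairs n d → ℂ} {p : Pairs n d}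
    (hF : AnalyticAt ℂ F p) (hH : AnalyticAt ℂ H p) : AnalyticAt ℂ (bracket R ρ lam F H) p := by
  have hZ : AnalyticAt ℂ (fun q : Pairs n d => offDiag q) p :=
    (LinearMap.toContinuousLinearMap (offDiag (n := n) (d := d))).analyticAt p
  have hX := analyticAt_linearMap (offDiag ∘ₗ gradOf) hF.fderiv
  have hY := analyticAt_linearMap (offDiag ∘ₗ gradOf) hH.fderiv
  have hτ {f : Pairs n d → Matrix (n ⊕ d) (n ⊕ d) ℂ} (hf : AnalyticAt ℂ f p) :
      AnalyticAt ℂ (fun q => (f q).trace) p :=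
    analyticAt_linearMap (Matrix.traceLinearMap (n ⊕ d) ℂ ℂ) hf
  have := analyticAt_const (v := (1 / 2 : ℂ)) |>.mul <|
    (hτ (((hZ.mul hX).sub (hX.mul hZ)).mul
      (analyticAt_linearMap (diagR R ρ) ((hZ.mul hY).sub (hY.mul hZ))))).neg.sub
    (hτ ((analyticAt_const (v := parity).mul ((hZ.mul hZ).add
      (analyticAt_const (v := lam • 1)))).mul ((hX.mul hY).sub (hY.mul hX))))
  refine this.congr (Filter.Eventually.of_forall fun q => ?_)
  rw [bracket_eq_gradOf, bivector_eq_offDiag]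
  rfl

/-- The iterated bracket. Only its first summand involves the derivative of the bivector; the second
derivatives of `G` and `H` cancel, by symmetry, in the cyclic sum. -/
theorem bracket_bracket {R : Matrix n n ℂ →ₗ[ℂ] Matrix n n ℂ}
    {ρ : Matrix d d ℂ →ₗ[ℂ] Matrix d d ℂ} (hR : IsRMatrix R) (hρ : IsRMatrix ρ) (lam : ℂ)
    (F : Pairs n d → ℂ) {G H : Pairs n d → ℂ} {p : Pairs n d}
    (hG : AnalyticAt ℂ G p) (hH : AnalyticAt ℂ H p) (u : Pairs n d)
    (hu : u = hamVec R ρ lam p (gradOf (fderiv ℂ F p))) (Z Y W : Matrix (n ⊕ d) (n ⊕ d) ℂ)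
    (hZ : Z = offDiag p) (hY : Y = offDiag (gradOf (fderiv ℂ G p)))
    (hW : W = offDiag (gradOf (fderiv ℂ H p))) :
    bracket R ρ lam F (bracket R ρ lam G H) p = (1 / 2 : ℂ) *
      (-(⁅offDiag u, Y⁆ * diagR R ρ ⁅Z, W⁆).trace + (diagR R ρ ⁅Z, Y⁆ * ⁅offDiag u, W⁆).trace
        - (parity * (offDiag u * Z + Z * offDiag u) * ⁅Y, W⁆).trace)
      + fderiv ℂ (fderiv ℂ H) p u (hamVec R ρ lam p (gradOf (fderiv ℂ G p)))
      - fderiv ℂ (fderiv ℂ G) p u (hamVec R ρ lam p (gradOf (fderiv ℂ H p))) := by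
  rw [bracket_eq_fderiv hR hρ, ← hu]
  have line : HasDerivAt (fun t : ℂ => p + t • u) u 0 := hasDerivAt_line p u
  have hp : p + (0 : ℂ) • u = p := by simp
  have grad {K : Pairs n d → ℂ} (hK : AnalyticAt ℂ K p) :
      HasDerivAt (fun t : ℂ => offDiag (gradOf (fderiv ℂ K (p + t • u))))
        (offDiag (gradOf (fderiv ℂ (fderiv ℂ K) p u))) 0 := by
    have h := hK.fderiv.differentiableAt.hasFDerivAt
    rw [← hp] at h
    have := hasDerivAt_linearMap (offDiag ∘ₗ gradOf) (h.comp_hasDerivAt (0 : ℂ) line)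
    rw [hp] at this
    exact this
  have h₀ := ((analyticAt_bracket R ρ lam hG hH).differentiableAt.hasFDerivAt)
  rw [← hp] at h₀
  have h₀ := h₀.comp_hasDerivAt (0 : ℂ) line
  rw [hp] at h₀
  have hZ' := hasDerivAt_linearMap offDiag line
  have hτ {f : ℂ → Matrix (n ⊕ d) (n ⊕ d) ℂ} {f'} (hf : HasDerivAt f f' 0) :
      HasDerivAt (fun q => (f q).trace) f'.trace 0 :=
    hasDerivAt_linearMap (Matrix.traceLinearMap (n ⊕ d) ℂ ℂ) hf
  have h₁ := ((hτ (((hZ'.mul (grad hG)).sub ((grad hG).mul hZ')).mul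
      (hasDerivAt_linearMap (diagR R ρ) ((hZ'.mul (grad hH)).sub ((grad hH).mul hZ'))))).neg.sub
    (hτ ((((hZ'.mul hZ').add_const (lam • 1)).const_mul parity).mul
      (((grad hG).mul (grad hH)).sub ((grad hH).mul (grad hG)))))).const_mul (1 / 2 : ℂ)
  have h₂ := h₀.unique (h₁.congr_of_eventuallyEq (Filter.Eventually.of_forall fun t => by
    simp only [Function.comp_apply]
    rw [bracket_eq_gradOf, bivector_eq_offDiag]
    rfl))
  refine h₂.trans ?_
  have k₁ : fderiv ℂ (fderiv ℂ H) p u (hamVec R ρ lam p (gradOf (fderiv ℂ G p))) =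
      (1 / 2 : ℂ) * (-(⁅Z, Y⁆ * diagR R ρ ⁅Z, offDiag (gradOf (fderiv ℂ (fderiv ℂ H) p u))⁆).trace
        - (parity * (Z * Z + lam • 1) *
          ⁅Y, offDiag (gradOf (fderiv ℂ (fderiv ℂ H) p u))⁆).trace) := by
    rw [apply_eq_trace, ← bivector_eq_trace_hamVec hR hρ, bivector_eq_offDiag, hZ, hY]
  have k₂ : -fderiv ℂ (fderiv ℂ G) p u (hamVec R ρ lam p (gradOf (fderiv ℂ H p))) =
      (1 / 2 : ℂ) * (-(⁅Z, offDiag (gradOf (fderiv ℂ (fderiv ℂ G) p u))⁆ * diagR R ρ ⁅Z, W⁆).trace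
        - (parity * (Z * Z + lam • 1) *
          ⁅offDiag (gradOf (fderiv ℂ (fderiv ℂ G) p u)), W⁆).trace) := by
    rw [apply_eq_trace, ← bivector_eq_trace_hamVec hR hρ, ← bivector_skew hR hρ,
      bivector_eq_offDiag, hZ, hW]
  rw [sub_eq_add_neg _ (fderiv ℂ (fderiv ℂ G) p u _), k₁, k₂,
    trace_diagR_mul hR hρ]
  simp only [Pi.mul_apply, Pi.sub_apply, hp, ← hZ, ← hY, ← hW]
  generalize offDiag (gradOf (fderiv ℂ (fderiv ℂ G) p u)) = Y'
  generalize offDiag (gradOf (fderiv ℂ (fderiv ℂ H) p u)) = W'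
  generalize offDiag u = U
  generalize parity (n := n) (d := d) = γ
  generalize diagR R ρ = T
  simp only [Ring.lie_def, mul_add, add_mul, mul_sub, sub_mul, map_add, map_sub,
    Matrix.trace_add, Matrix.trace_sub]
  ring

/-- The quadratic bracket defined by two r-matrices is a Poisson bracket. -/
theorem isPoissonBracket_bracket {R : Matrix n n ℂ →ₗ[ℂ] Matrix n n ℂ}
    {ρ : Matrix d d ℂ →ₗ[ℂ] Matrix d d ℂ} (hR : IsRMatrix R) (hρ : IsRMatrix ρ) (lam : ℂ) :
    IsPoissonBracket (bracket R ρ lam) where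
  analytic F H p hF hH := analyticAt_bracket R ρ lam hF hH
  congr F F' H p h := by
    have e : fderiv ℂ F p = fderiv ℂ F' p := h.fderiv_eq
    rw [bracket_eq_gradOf, bracket_eq_gradOf, e]
  skew F H p _ _ := bracket_skew hR hρ ..
  linear a b F G H p hF hG _ := by
    have e : fderiv ℂ (a • F + b • G) p = a • fderiv ℂ F p + b • fderiv ℂ G p :=
      ((hF.differentiableAt.hasFDerivAt.const_smul a).add
        (hG.differentiableAt.hasFDerivAt.const_smul b)).fderiv
    rw [bracket_skew hR hρ, bracket_skew hR hρ _ F, bracket_skew hR hρ _ G,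
      bracket_eq_fderiv hR hρ, bracket_eq_fderiv hR hρ, bracket_eq_fderiv hR hρ, e]
    simp only [add_apply, smul_apply, smul_eq_mul]
    ring
  leibniz F G H p hF hG _ := by
    have e : fderiv ℂ (F * G) p = F p • fderiv ℂ G p + G p • fderiv ℂ F p :=
      (hF.differentiableAt.hasFDerivAt.mul hG.differentiableAt.hasFDerivAt).fderiv
    rw [bracket_skew hR hρ, bracket_skew hR hρ _ F, bracket_skew hR hρ _ G,
      bracket_eq_fderiv hR hρ, bracket_eq_fderiv hR hρ, bracket_eq_fderiv hR hρ, e]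
    simp only [add_apply, smul_apply, smul_eq_mul]
    ring
  jacobi F G H p hF hG hH := by
    have symm {K : Pairs n d → ℂ} (hK : AnalyticAt ℂ K p) (a b : Pairs n d) :
        fderiv ℂ (fderiv ℂ K) p a b = fderiv ℂ (fderiv ℂ K) p b a :=
      (hK.contDiffAt (n := ⊤)).isSymmSndFDerivAt_of_omega a b
    have odd (q : Pairs n d) : offDiag q * parity = -(parity * offDiag q) := by
      simp [offDiag_apply, parity, Matrix.fromBlocks_multiply, Matrix.fromBlocks_neg]
    have even (q : Pairs n d) : diagR R ρ ⁅offDiag p, offDiag q⁆ * parity =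
        parity * diagR R ρ ⁅offDiag p, offDiag q⁆ := by
      simp [diagR_lie_offDiag, parity, Matrix.fromBlocks_multiply]
    have hγ : (parity (n := n) (d := d)) * parity = 1 := by
      simp [parity, Matrix.fromBlocks_multiply]
    rw [bracket_bracket hR hρ lam F hG hH _ rfl _ _ _ rfl rfl rfl,
      bracket_bracket hR hρ lam G hH hF _ rfl _ _ _ rfl rfl rfl,
      bracket_bracket hR hρ lam H hF hG _ rfl _ _ _ rfl rfl rfl]
    have J := jacobi_of_tracial (Matrix.traceLinearMap (n ⊕ d) ℂ ℂ) Matrix.trace_mul_comm lam parity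
      (offDiag p) (offDiag (gradOf (fderiv ℂ F p))) (offDiag (gradOf (fderiv ℂ G p)))
      (offDiag (gradOf (fderiv ℂ H p))) _ _ _ hγ (odd _) (odd _) (odd _) (odd _) (even _) (even _)
      (even _) (trace_yangBaxter_offDiag hR hρ p _ _ _) _ _ _ (offDiag_hamVec R ρ lam p _)
      (offDiag_hamVec R ρ lam p _) (offDiag_hamVec R ρ lam p _)
    have lie_smul (c : ℂ) (A B : Matrix (n ⊕ d) (n ⊕ d) ℂ) : ⁅c • A, B⁆ = c • ⁅A, B⁆ := by
      simp only [Ring.lie_def, smul_mul_assoc, mul_smul_comm, smul_sub]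
    simp only [lie_smul, smul_mul_assoc, mul_smul_comm, ← smul_add, map_smul, smul_eq_mul,
      Matrix.traceLinearMap_apply] at J
    linear_combination (1 / 4) * J + symm hF (hamVec R ρ lam p (gradOf (fderiv ℂ G p)))
      (hamVec R ρ lam p (gradOf (fderiv ℂ H p))) +
      symm hG (hamVec R ρ lam p (gradOf (fderiv ℂ H p)))
      (hamVec R ρ lam p (gradOf (fderiv ℂ F p))) +
      symm hH (hamVec R ρ lam p (gradOf (fderiv ℂ F p)))
      (hamVec R ρ lam p (gradOf (fderiv ℂ G p)))
end

/-! ### The Lie algebra of the dual group and the adjoint action -/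

theorem hasSum_exp_apply {E : Type*} [NormedAddCommGroup E] [NormedSpace ℂ E] [CompleteSpace E]
    (T : E →L[ℂ] E) (y : E) :
    HasSum (fun k : ℕ => (k.factorial⁻¹ : ℂ) • (T ^ k) y) (NormedSpace.exp T y) := by
  simpa using (NormedSpace.exp_series_hasSum_exp' (𝕂 := ℂ) T).mapL
    (ContinuousLinearMap.apply ℂ E y)

/-- If `P` intertwines the endomorphism `D` with the inner derivation `[a, ·]`, then it intertwines
`exp D` with conjugation by `exp a`. -/
theorem map_exp_apply_of_intertwines {E 𝔸 : Type*} [NormedAddCommGroup E] [NormedSpace ℂ E]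
    [CompleteSpace E] [NormedRing 𝔸] [NormedAlgebra ℂ 𝔸] [CompleteSpace 𝔸]
    (P : E →L[ℂ] 𝔸) (D : E →L[ℂ] E) (a : 𝔸) (h : ∀ y, P (D y) = a * P y - P y * a) (z : E) :
    P (NormedSpace.exp D z) = NormedSpace.exp a * P z * NormedSpace.exp (-a) := by
  let l : 𝔸 →L[ℂ] 𝔸 := ContinuousLinearMap.mul ℂ 𝔸 a
  let r : 𝔸 →L[ℂ] 𝔸 := (ContinuousLinearMap.mul ℂ 𝔸).flip (-a)
  have hl (y : 𝔸) : NormedSpace.exp l y = NormedSpace.exp a * y := by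
    refine (hasSum_exp_apply l y).unique ?_
    have e : (fun k : ℕ => (k.factorial⁻¹ : ℂ) • (l ^ k) y) =
        fun k : ℕ => (k.factorial⁻¹ : ℂ) • a ^ k * y := by
      funext k
      rw [smul_mul_assoc]
      congr 1
      induction k with
      | zero => simp
      | succ k ih => rw [pow_succ', pow_succ', mul_assoc, ← ih]; rfl
    rw [e]
    exact (NormedSpace.exp_series_hasSum_exp' (𝕂 := ℂ) a).mul_right y
  have hr (y : 𝔸) : NormedSpace.exp r y = y * NormedSpace.exp (-a) := by
    refine (hasSum_exp_apply r y).unique ?_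
    have e : (fun k : ℕ => (k.factorial⁻¹ : ℂ) • (r ^ k) y) =
        fun k : ℕ => y * (k.factorial⁻¹ : ℂ) • (-a) ^ k := by
      funext k
      rw [mul_smul_comm]
      congr 1
      induction k with
      | zero => simp
      | succ k ih => rw [pow_succ', pow_succ, ← mul_assoc, ← ih]; rfl
    rw [e]
    exact (NormedSpace.exp_series_hasSum_exp' (𝕂 := ℂ) (-a)).mul_left y
  have comm : Commute l r := by
    ext y
    exact (mul_assoc a y (-a)).symm
  have key : P (NormedSpace.exp D z) = NormedSpace.exp (l + r) (P z) := by
    refine HasSum.unique ((hasSum_exp_apply D z).mapL P) ?_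
    have e : (fun k : ℕ => P ((k.factorial⁻¹ : ℂ) • (D ^ k) z)) =
        fun k : ℕ => (k.factorial⁻¹ : ℂ) • ((l + r) ^ k) (P z) := by
      funext k
      rw [map_smul]
      congr 1
      induction k with
      | zero => simp
      | succ k ih =>
        rw [pow_succ', pow_succ']
        change P (D ((D ^ k) z)) = l (((l + r) ^ k) (P z)) + r (((l + r) ^ k) (P z))
        rw [h, ih]
        simp [l, r, sub_eq_add_neg]
    rw [e]
    exact hasSum_exp_apply (l + r) (P z)
  let _ : NormedAlgebra ℚ (𝔸 →L[ℂ] 𝔸) := NormedAlgebra.restrictScalars ℚ ℂ _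
  rw [key, NormedSpace.exp_add_of_commute comm]
  change NormedSpace.exp l (NormedSpace.exp r (P z)) = _
  rw [hr, hl, mul_assoc]

theorem exists_exp_conj {E 𝔸 : Type*} [NormedAddCommGroup E] [NormedSpace ℂ E]
    [FiniteDimensional ℂ E] [NormedRing 𝔸] [NormedAlgebra ℂ 𝔸] [CompleteSpace 𝔸]
    (P Q : E →ₗ[ℂ] 𝔸) (D : E →ₗ[ℂ] E) (a b : 𝔸) (hP : ∀ y, P (D y) = a * P y - P y * a)
    (hQ : ∀ y, Q (D y) = b * Q y - Q y * b) (z : E) :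
    ∃ z', NormedSpace.exp a * P z * NormedSpace.exp (-a) = P z' ∧
      NormedSpace.exp b * Q z * NormedSpace.exp (-b) = Q z' := by
  have : CompleteSpace E := FiniteDimensional.complete ℂ E
  exact ⟨NormedSpace.exp (LinearMap.toContinuousLinearMap D) z,
    (map_exp_apply_of_intertwines (LinearMap.toContinuousLinearMap P)
      (LinearMap.toContinuousLinearMap D) a hP z).symm,
    (map_exp_apply_of_intertwines (LinearMap.toContinuousLinearMap Q)
      (LinearMap.toContinuousLinearMap D) b hQ z).symm⟩

section
variable {n : Type*}

/-- `plusPart` as a linear map. -/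
def plusL (R : Matrix n n ℂ →ₗ[ℂ] Matrix n n ℂ) : Matrix n n ℂ →ₗ[ℂ] Matrix n n ℂ :=
  (1 / 2 : ℂ) • (R + LinearMap.id)

/-- `minusPart` as a linear map. -/
def minusL (R : Matrix n n ℂ →ₗ[ℂ] Matrix n n ℂ) : Matrix n n ℂ →ₗ[ℂ] Matrix n n ℂ :=
  (1 / 2 : ℂ) • (R - LinearMap.id)

theorem plusPart_minusPart_comm (R : Matrix n n ℂ →ₗ[ℂ] Matrix n n ℂ) (X : Matrix n n ℂ) :
    plusPart R (minusPart R X) = minusPart R (plusPart R X) := by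
  simp only [plusPart, minusPart, map_smul, map_add, map_sub]
  module

variable [Fintype n] [DecidableEq n]

theorem IsRMatrix.trace_plusPart_mul {R : Matrix n n ℂ →ₗ[ℂ] Matrix n n ℂ} (h : IsRMatrix R)
    (A B : Matrix n n ℂ) : (plusPart R A * B).trace = -(A * minusPart R B).trace := by
  simp only [plusPart, minusPart, Matrix.smul_mul, Matrix.mul_smul, Matrix.add_mul, Matrix.mul_sub,
    Matrix.trace_smul, Matrix.trace_add, Matrix.trace_sub, h.skew, smul_eq_mul]
  ring

theorem IsRMatrix.trace_minusPart_mul {R : Matrix n n ℂ →ₗ[ℂ] Matrix n n ℂ} (h : IsRMatrix R)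
    (A B : Matrix n n ℂ) : (minusPart R A * B).trace = -(A * plusPart R B).trace := by
  rw [Matrix.trace_mul_comm, ← neg_eq_iff_eq_neg, Matrix.trace_mul_comm A, h.trace_plusPart_mul]

theorem trace_mul_plusPart_minusPart {R : Matrix n n ℂ →ₗ[ℂ] Matrix n n ℂ} (hR : IsRMatrix R)
    (A B C : Matrix n n ℂ) : ((plusPart R B - minusPart R A) * C).trace =
      (A * plusPart R C).trace - (B * minusPart R C).trace := by
  rw [Matrix.sub_mul, Matrix.trace_sub, hR.trace_plusPart_mul, hR.trace_minusPart_mul]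
  ring

/-- The Lie algebra of the dual group is isotropic in the double. -/
theorem IsRMatrix.trace_isotropic {R : Matrix n n ℂ →ₗ[ℂ] Matrix n n ℂ} (h : IsRMatrix R)
    (X Z : Matrix n n ℂ) : (plusPart R X * plusPart R Z).trace =
      (minusPart R X * minusPart R Z).trace := by
  rw [h.trace_plusPart_mul, h.trace_minusPart_mul, plusPart_minusPart_comm]

/-- The bracket `[X, Y]_R = ([R X, Y] + [X, R Y]) / 2` with `X` fixed. -/
def adR (R : Matrix n n ℂ →ₗ[ℂ] Matrix n n ℂ) (X : Matrix n n ℂ) :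
    Matrix n n ℂ →ₗ[ℂ] Matrix n n ℂ where
  toFun Y := (1 / 2 : ℂ) • (⁅R X, Y⁆ + ⁅X, R Y⁆)
  map_add' Y Z := by
    simp only [Ring.lie_def, map_add, mul_add, add_mul]
    module
  map_smul' c Y := by
    simp only [Ring.lie_def, map_smul, mul_smul_comm, smul_mul_assoc, RingHom.id_apply]
    module

/-- By the Yang-Baxter equation, `X ↦ X₊` intertwines `[·, ·]_R` with the commutator. -/
theorem IsRMatrix.plusPart_adR {R : Matrix n n ℂ →ₗ[ℂ] Matrix n n ℂ} (h : IsRMatrix R)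
    (X Y : Matrix n n ℂ) : plusPart R (adR R X Y) =
      plusPart R X * plusPart R Y - plusPart R Y * plusPart R X := by
  have yb : ⁅R X, R Y⁆ + ⁅X, Y⁆ = R (⁅R X, Y⁆ + ⁅X, R Y⁆) := by
    rw [← sub_eq_zero, ← h.yangBaxter X Y]; abel
  change (1 / 2 : ℂ) • (R ((1 / 2 : ℂ) • _) + (1 / 2 : ℂ) • _) = _
  rw [map_smul, ← yb]
  simp only [plusPart, Ring.lie_def, smul_mul_assoc, mul_smul_comm, mul_add, add_mul]
  module

/-- By the Yang-Baxter equation, `X ↦ X₋` intertwines `[·, ·]_R` with the commutator. -/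
theorem IsRMatrix.minusPart_adR {R : Matrix n n ℂ →ₗ[ℂ] Matrix n n ℂ} (h : IsRMatrix R)
    (X Y : Matrix n n ℂ) : minusPart R (adR R X Y) =
      minusPart R X * minusPart R Y - minusPart R Y * minusPart R X := by
  have yb : ⁅R X, R Y⁆ + ⁅X, Y⁆ = R (⁅R X, Y⁆ + ⁅X, R Y⁆) := by
    rw [← sub_eq_zero, ← h.yangBaxter X Y]; abel
  change (1 / 2 : ℂ) • (R ((1 / 2 : ℂ) • _) - (1 / 2 : ℂ) • _) = _
  rw [map_smul, ← yb]
  simp only [minusPart, Ring.lie_def, smul_mul_assoc, mul_smul_comm, mul_sub, sub_mul]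
  module

theorem val_inv_eq_exp_neg (g : Matrix.GeneralLinearGroup n ℂ) {A : Matrix n n ℂ}
    (hg : (g : Matrix n n ℂ) = NormedSpace.exp A) :
    ((g⁻¹ : Matrix.GeneralLinearGroup n ℂ) : Matrix n n ℂ) = NormedSpace.exp (-A) := by
  rw [Matrix.coe_units_inv, hg, Matrix.exp_neg]

/-- The adjoint action of the dual group preserves its Lie algebra. -/
theorem IsRMatrix.adjoint_mem {R : Matrix n n ℂ →ₗ[ℂ] Matrix n n ℂ} (h : IsRMatrix R)
    {p : Matrix.GeneralLinearGroup n ℂ × Matrix.GeneralLinearGroup n ℂ} (hp : p ∈ dualGroup R)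
    (Z : Matrix n n ℂ) : ∃ Z' : Matrix n n ℂ,
      (p.1 : Matrix n n ℂ) * plusPart R Z * (p.1⁻¹ : Matrix.GeneralLinearGroup n ℂ) =
        plusPart R Z' ∧
      (p.2 : Matrix n n ℂ) * minusPart R Z * (p.2⁻¹ : Matrix.GeneralLinearGroup n ℂ) =
        minusPart R Z' := by
  let Q (p : Matrix.GeneralLinearGroup n ℂ × Matrix.GeneralLinearGroup n ℂ) : Prop :=
    ∀ Z : Matrix n n ℂ, ∃ Z' : Matrix n n ℂ,
      (p.1 : Matrix n n ℂ) * plusPart R Z * (p.1⁻¹ : Matrix.GeneralLinearGroup n ℂ) =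
        plusPart R Z' ∧
      (p.2 : Matrix n n ℂ) * minusPart R Z * (p.2⁻¹ : Matrix.GeneralLinearGroup n ℂ) =
        minusPart R Z'
  have gen (p) (X : Matrix n n ℂ) (h₁ : (p.1 : Matrix n n ℂ) = NormedSpace.exp (plusPart R X))
      (h₂ : (p.2 : Matrix n n ℂ) = NormedSpace.exp (minusPart R X)) : Q p := by
    intro Z
    rw [val_inv_eq_exp_neg _ h₁, val_inv_eq_exp_neg _ h₂, h₁, h₂]
    exact exists_exp_conj (plusL R) (minusL R) (adR R X) _ _ (h.plusPart_adR X)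
      (h.minusPart_adR X) Z
  -- the inverse is carried along in the induction, since invariance under `p` is not
  -- formally that under `p⁻¹`
  suffices Q p ∧ Q p⁻¹ from this.1 Z
  induction hp using Subgroup.closure_induction with
  | mem p hp =>
    obtain ⟨X, h₁, h₂⟩ := hp
    have e₁ : plusPart R (-X) = -plusPart R X := map_neg (plusL R) X
    have e₂ : minusPart R (-X) = -minusPart R X := map_neg (minusL R) X
    refine ⟨gen p X h₁ h₂, gen p⁻¹ (-X) ?_ ?_⟩
    · rw [e₁, ← val_inv_eq_exp_neg _ h₁, Prod.fst_inv]
    · rw [e₂, ← val_inv_eq_exp_neg _ h₂, Prod.snd_inv]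
  | one => exact ⟨fun Z => ⟨Z, by simp⟩, fun Z => ⟨Z, by simp⟩⟩
  | mul p q _ _ hp hq =>
    have mul {p q} (hp : Q p) (hq : Q q) : Q (p * q) := by
      intro Z
      obtain ⟨Z₁, a₁, b₁⟩ := hq Z
      obtain ⟨Z₂, a₂, b₂⟩ := hp Z₁
      refine ⟨Z₂, ?_, ?_⟩
      · rw [← a₂, ← a₁]
        simp only [Prod.fst_mul, mul_inv_rev, Units.val_mul, mul_assoc]
      · rw [← b₂, ← b₁]
        simp only [Prod.snd_mul, mul_inv_rev, Units.val_mul, mul_assoc]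
    rw [mul_inv_rev]
    exact ⟨mul hp.1 hq.1, mul hq.2 hp.2⟩
  | inv p _ hp => rw [inv_inv]; exact hp.symm

end

/-! ### The momentum map -/

section
variable {n d : Type*} [Fintype n] [Fintype d] [DecidableEq n]

/-- The momentum map `L = lam + v wᵀ` generates the infinitesimal action of `gl(n)`: the covector
`tr (δL N)` has the Hamiltonian vector `(-K v, wᵀ K)`, where `K = (N L)₊ - (L N)₋`. -/
theorem hamVec_momentum (R : Matrix n n ℂ →ₗ[ℂ] Matrix n n ℂ)
    (ρ : Matrix d d ℂ →ₗ[ℂ] Matrix d d ℂ) (lam : ℂ) (p : Pairs n d) (L N : Matrix n n ℂ)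
    (hL : L = lam • 1 + p.1 * p.2) :
    hamVec R ρ lam p (N * p.1, p.2 * N) =
      (-((plusPart R (N * L) - minusPart R (L * N)) * p.1),
        p.2 * (plusPart R (N * L) - minusPart R (L * N))) := by
  have e : p.1 * (p.2 * N) - N * p.1 * p.2 = L * N - N * L := by
    rw [hL]
    simp only [Matrix.add_mul, Matrix.mul_add, Matrix.smul_mul, Matrix.mul_smul, Matrix.one_mul,
      Matrix.mul_one, Matrix.mul_assoc]
    abel
  have e' : p.2 * N * p.1 - p.2 * (N * p.1) = 0 := by rw [Matrix.mul_assoc, sub_self]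
  have c₁ : N * p.1 * p.2 = N * L - lam • N := by
    rw [hL, Matrix.mul_add, Matrix.mul_smul, Matrix.mul_one, Matrix.mul_assoc]; abel
  have c₂ : p.1 * p.2 * N = L * N - lam • N := by
    rw [hL, Matrix.add_mul, Matrix.smul_mul, Matrix.one_mul]; abel
  have f₁ : N * p.1 * p.2 * p.1 + p.1 * p.2 * (N * p.1) =
      (N * L - lam • N + (L * N - lam • N)) * p.1 := by
    rw [← c₁, ← c₂, Matrix.add_mul, Matrix.mul_assoc (p.1 * p.2)]
  have f₂ : p.2 * p.1 * (p.2 * N) + p.2 * N * p.1 * p.2 =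
      p.2 * (N * L - lam • N + (L * N - lam • N)) := by
    rw [← c₁, ← c₂, Matrix.mul_add]
    simp only [Matrix.mul_assoc]
    abel
  simp only [hamVec, e, e', f₁, f₂, map_zero, Matrix.mul_zero, Matrix.zero_mul, plusPart,
    minusPart, map_sub]
  ext1
  · simp only [Matrix.sub_mul, Matrix.add_mul, Matrix.smul_mul, smul_add, smul_sub]
    module
  · simp only [Matrix.mul_sub, Matrix.mul_add, Matrix.mul_smul, smul_add, smul_sub]
    module

variable [DecidableEq d]

theorem bivector_add_right {R : Matrix n n ℂ →ₗ[ℂ] Matrix n n ℂ}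
    {ρ : Matrix d d ℂ →ₗ[ℂ] Matrix d d ℂ} (hR : IsRMatrix R) (hρ : IsRMatrix ρ) (lam : ℂ)
    (p f g h : Pairs n d) :
    bivector R ρ lam p.1 p.2 f.2 f.1 (g + h).2 (g + h).1 =
      bivector R ρ lam p.1 p.2 f.2 f.1 g.2 g.1 + bivector R ρ lam p.1 p.2 f.2 f.1 h.2 h.1 := by
  rw [bivector_eq_trace_hamVec hR hρ, bivector_eq_trace_hamVec hR hρ,
    bivector_eq_trace_hamVec hR hρ, map_add, mul_add, Matrix.trace_add]

theorem bivector_add_left {R : Matrix n n ℂ →ₗ[ℂ] Matrix n n ℂ}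
    {ρ : Matrix d d ℂ →ₗ[ℂ] Matrix d d ℂ} (hR : IsRMatrix R) (hρ : IsRMatrix ρ) (lam : ℂ)
    (p f g h : Pairs n d) :
    bivector R ρ lam p.1 p.2 (f + g).2 (f + g).1 h.2 h.1 =
      bivector R ρ lam p.1 p.2 f.2 f.1 h.2 h.1 + bivector R ρ lam p.1 p.2 g.2 g.1 h.2 h.1 := by
  rw [bivector_skew hR hρ, bivector_add_right hR hρ, bivector_skew hR hρ lam p.1 p.2 f.2,
    bivector_skew hR hρ lam p.1 p.2 g.2, neg_add]

/-- The bivector on covectors which are modified by the differential of the momentum map. -/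
theorem bivector_add_momentum {R : Matrix n n ℂ →ₗ[ℂ] Matrix n n ℂ}
    {ρ : Matrix d d ℂ →ₗ[ℂ] Matrix d d ℂ} (hR : IsRMatrix R) (hρ : IsRMatrix ρ) (lam : ℂ)
    (p g h : Pairs n d) (L N N' K K' : Matrix n n ℂ) (hL : L = lam • 1 + p.1 * p.2)
    (hK : K = plusPart R (N * L) - minusPart R (L * N))
    (hK' : K' = plusPart R (N' * L) - minusPart R (L * N')) :
    bivector R ρ lam p.1 p.2 (g.2 + p.2 * N) (g.1 + N * p.1) (h.2 + p.2 * N') (h.1 + N' * p.1) =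
      bivector R ρ lam p.1 p.2 g.2 g.1 h.2 h.1 - (K * (p.1 * h.2 - h.1 * p.2)).trace
        + (K' * (p.1 * g.2 - g.1 * p.2)).trace - (K * (L * N' - N' * L)).trace := by
  have mom (M M' : Matrix n n ℂ) (hM : M' = plusPart R (M * L) - minusPart R (L * M))
      (f : Pairs n d) : bivector R ρ lam p.1 p.2 (p.2 * M) (M * p.1) f.2 f.1 =
        -(M' * (p.1 * f.2 - f.1 * p.2)).trace := by
    have := bivector_eq_trace_hamVec hR hρ lam p (M * p.1, p.2 * M) f
    rw [hamVec_momentum R ρ lam p L M hL, ← hM, trace_offDiag_mul] at this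
    refine this.trans ?_
    have c := Matrix.trace_mul_comm p.2 (M' * f.1)
    simp only [Matrix.neg_mul, Matrix.mul_sub, Matrix.trace_sub, Matrix.trace_neg,
      Matrix.mul_assoc] at c ⊢
    linear_combination c
  have e : p.1 * (p.2 * N') - N' * p.1 * p.2 = L * N' - N' * L := by
    rw [hL]
    simp only [Matrix.add_mul, Matrix.mul_add, Matrix.smul_mul, Matrix.mul_smul, Matrix.one_mul,
      Matrix.mul_one, Matrix.mul_assoc]
    abel
  have b₁ := bivector_add_left hR hρ lam p g (N * p.1, p.2 * N) (h + (N' * p.1, p.2 * N'))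
  have b₂ := bivector_add_right hR hρ lam p g h (N' * p.1, p.2 * N')
  have m₁ := mom N K hK (h + (N' * p.1, p.2 * N'))
  have m₂ := bivector_skew hR hρ lam p.1 p.2 g.2 g.1 (p.2 * N') (N' * p.1)
  rw [mom N' K' hK'] at m₂
  simp only [Prod.fst_add, Prod.snd_add] at b₁ b₂ m₁
  rw [b₁, b₂, m₁, m₂, ← e]
  simp only [Matrix.mul_add, Matrix.add_mul, Matrix.mul_sub, Matrix.trace_add, Matrix.trace_sub]
  ring
end

section
variable {n : Type*} [Fintype n] [DecidableEq n]

/-- The pairing of `K` with `P - Q`, where `K` is the component along the diagonal of the element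
`(A, B)` of the double, and `(P, Q)` has the same component `K'` along the diagonal as `(A', B')`,
since the two differ by an element of the Lie algebra of the dual group. -/
theorem trace_lie_momentum {R : Matrix n n ℂ →ₗ[ℂ] Matrix n n ℂ} (hR : IsRMatrix R)
    (A B A' B' Z P Q K K' : Matrix n n ℂ) (hP : P = A' + plusPart R Z)
    (hQ : Q = B' + minusPart R Z) (hK : K = plusPart R B - minusPart R A)
    (hK' : K' = plusPart R B' - minusPart R A') :
    (K * (P - Q)).trace = (A * P).trace - (B * Q).trace - ((A - B) * K').trace := by
  have e₁ : plusPart R (P - Q) = P - K' := by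
    rw [hP, hQ, hK']
    simp only [plusPart, minusPart, map_add, map_sub, map_smul]
    module
  have e₂ : minusPart R (P - Q) = Q - K' := by
    rw [hP, hQ, hK']
    simp only [plusPart, minusPart, map_add, map_sub, map_smul]
    module
  rw [hK, trace_mul_plusPart_minusPart hR, e₁, e₂]
  simp only [Matrix.mul_sub, Matrix.sub_mul, Matrix.trace_sub]
  ring

end

/-! ### The bivector of the concatenated space -/

section
variable {n d₁ d₂ : Type*} [Fintype n] [Fintype d₁] [Fintype d₂]

/-- The second bracket at a point `(V, Wᵀ)`, written in terms of `V' = g V` and `W' = Wᵀ h`. The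
correction on the left is a part of the bracket of two momentum covectors; it removes the r-matrix
and the words which are not functions of `V'`, `W'` and `L`. -/
theorem bivector_dressing (R : Matrix n n ℂ →ₗ[ℂ] Matrix n n ℂ)
    (ρ : Matrix d₂ d₂ ℂ →ₗ[ℂ] Matrix d₂ d₂ ℂ) (V V' : Matrix n d₂ ℂ) (W W' : Matrix d₂ n ℂ)
    (g h L : Matrix n n ℂ) (hL : g * h = L) (hV : g * V = V') (hW : W * h = W')
    (x : Matrix d₂ n ℂ) (ξ : Matrix n d₂ ℂ) (y : Matrix d₂ n ℂ) (η : Matrix n d₂ ℂ) :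
    bivector R ρ 1 V W (x * g) (h * ξ) (y * g) (h * η)
      - ((V * (x * g) - h * ξ * W) *
        (plusPart R (h * η * W) - minusPart R (V * (y * g)))).trace =
    (1 / 2 : ℂ) * (-(V' * x * V' * y).trace + (ξ * W' * η * W').trace
      - ((x * V' - W' * ξ) * ρ (y * V' - W' * η)).trace + (V' * W' * (η * x - ξ * y)).trace
      + 2 * (x * L * η - y * L * ξ).trace) := by
  have e₁ : x * g * V = x * V' := by rw [Matrix.mul_assoc, hV]
  have e₂ : y * g * V = y * V' := by rw [Matrix.mul_assoc, hV]
  have e₃ : W * (h * ξ) = W' * ξ := by rw [← Matrix.mul_assoc, hW]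
  have e₄ : W * (h * η) = W' * η := by rw [← Matrix.mul_assoc, hW]
  have c₁ : (V * (x * g) * (V * (y * g))).trace = (V' * x * V' * y).trace := by
    rw [← hV, ← Matrix.mul_assoc V y, ← Matrix.mul_assoc _ _ g, Matrix.trace_mul_comm]
    simp only [Matrix.mul_assoc]
  have c₂ : (h * ξ * W * (h * η * W)).trace = (ξ * W' * η * W').trace := by
    rw [← hW, Matrix.mul_assoc, Matrix.mul_assoc, Matrix.trace_mul_comm]
    simp only [Matrix.mul_assoc]
  have c₃ : (V * (x * g) * (h * η * W)).trace = (W * V * (x * g * (h * η))).trace := by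
    rw [← Matrix.mul_assoc _ _ W, Matrix.trace_mul_comm]
    simp only [Matrix.mul_assoc]
  have c₄ : (h * ξ * W * (V * (y * g))).trace = (W * V * (y * g * (h * ξ))).trace := by
    rw [Matrix.mul_assoc, Matrix.trace_mul_comm]
    simp only [Matrix.mul_assoc]
  have c₅ : (V * W * (h * η * (x * g))).trace = (V' * W' * (η * x)).trace := by
    rw [← hV, ← hW, ← Matrix.mul_assoc _ x, ← Matrix.mul_assoc _ _ g, Matrix.trace_mul_comm]
    simp only [Matrix.mul_assoc]
  have c₆ : (V * W * (h * ξ * (y * g))).trace = (V' * W' * (ξ * y)).trace := by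
    rw [← hV, ← hW, ← Matrix.mul_assoc _ y, ← Matrix.mul_assoc _ _ g, Matrix.trace_mul_comm]
    simp only [Matrix.mul_assoc]
  have f₁ : x * g * (h * η) = x * L * η := by rw [← hL]; simp only [Matrix.mul_assoc]
  have f₂ : y * g * (h * ξ) = y * L * ξ := by rw [← hL]; simp only [Matrix.mul_assoc]
  rw [f₁] at c₃
  rw [f₂] at c₄
  simp only [bivector, plusPart, minusPart, e₁, e₂, e₃, e₄, f₁, f₂]
  simp only [map_sub, Matrix.mul_sub, Matrix.sub_mul, Matrix.mul_add, Matrix.trace_sub,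
    Matrix.trace_add, Matrix.mul_smul, Matrix.trace_smul, smul_eq_mul, c₁, c₂, c₃, c₄, c₅, c₆]
  ring

variable [DecidableEq n]

/-- The bracket on the concatenated space in terms of blocks. -/
theorem bivector_blockR (R : Matrix n n ℂ →ₗ[ℂ] Matrix n n ℂ)
    (ρ₁ : Matrix d₁ d₁ ℂ →ₗ[ℂ] Matrix d₁ d₁ ℂ) (ρ₂ : Matrix d₂ d₂ ℂ →ₗ[ℂ] Matrix d₂ d₂ ℂ) (lam : ℂ)
    (v : Matrix n d₁ ℂ) (V : Matrix n d₂ ℂ) (w : Matrix d₁ n ℂ) (W : Matrix d₂ n ℂ)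
    (x₁ : Matrix d₁ n ℂ) (x₂ : Matrix d₂ n ℂ) (ξ₁ : Matrix n d₁ ℂ) (ξ₂ : Matrix n d₂ ℂ)
    (y₁ : Matrix d₁ n ℂ) (y₂ : Matrix d₂ n ℂ) (η₁ : Matrix n d₁ ℂ) (η₂ : Matrix n d₂ ℂ) :
    bivector R (blockR ρ₁ ρ₂) lam (Matrix.fromCols v V) (Matrix.fromRows w W)
      (Matrix.fromRows x₁ x₂) (Matrix.fromCols ξ₁ ξ₂) (Matrix.fromRows y₁ y₂)
      (Matrix.fromCols η₁ η₂) =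
    bivector R ρ₁ lam v w x₁ ξ₁ y₁ η₁
      + (1 / 2 : ℂ) * (-((v * x₁ - ξ₁ * w) * R (V * y₂ - η₂ * W)).trace
        - ((V * x₂ - ξ₂ * W) * R (v * y₁ - η₁ * w)).trace
        - ((V * x₂ - ξ₂ * W) * R (V * y₂ - η₂ * W)).trace
        - ((x₂ * V - W * ξ₂) * ρ₂ (y₂ * V - W * η₂)).trace
        - ((V * x₂ + ξ₂ * W) * (v * y₁ - η₁ * w)).trace
        + ((V * y₂ + η₂ * W) * (v * x₁ - ξ₁ * w)).trace
        + (V * W * (η₂ * x₂ - ξ₂ * y₂)).trace + (W * V * (x₂ * η₂ - y₂ * ξ₂)).trace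
        + 2 * (x₂ * (lam • (1 : Matrix n n ℂ) + v * w) * η₂
          - y₂ * (lam • (1 : Matrix n n ℂ) + v * w) * ξ₂).trace) := by
  have e₁ : v * x₁ + V * x₂ - (ξ₁ * w + ξ₂ * W) = v * x₁ - ξ₁ * w + (V * x₂ - ξ₂ * W) := by abel
  have e₂ : v * y₁ + V * y₂ - (η₁ * w + η₂ * W) = v * y₁ - η₁ * w + (V * y₂ - η₂ * W) := by abel
  simp only [bivector, Matrix.fromCols_mul_fromRows, Matrix.fromRows_mul_fromCols, fromBlocks_sub,
    blockR_fromBlocks, Matrix.fromBlocks_multiply, trace_fromBlocks, e₁, e₂, Matrix.trace_add]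
  generalize ρ₁ _ = r₁
  generalize ρ₂ _ = r₂
  have lin : R (v * y₁ - η₁ * w + (V * y₂ - η₂ * W)) =
    R (v * y₁ - η₁ * w) + R (V * y₂ - η₂ * W) := map_add ..
  rw [lin]
  generalize R (v * y₁ - η₁ * w) = s₁
  generalize R (V * y₂ - η₂ * W) = s₂
  have c₁ := Matrix.trace_mul_comm x₁ (V * y₂ * v)
  have c₂ := Matrix.trace_mul_comm (w * ξ₂) (y₂ * v)
  have c₃ := Matrix.trace_mul_comm (v * w * ξ₂) y₂
  have c₄ := Matrix.trace_mul_comm x₁ (V * W * η₁)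
  have c₅ := Matrix.trace_mul_comm w (ξ₂ * W * η₁)
  have c₆ := Matrix.trace_mul_comm V (x₂ * v * y₁)
  have c₇ := Matrix.trace_mul_comm V (W * ξ₁ * y₁)
  have c₈ := Matrix.trace_mul_comm x₂ (v * w * η₂)
  have c₉ := Matrix.trace_mul_comm η₂ (W * ξ₁ * w)
  have c₁₀ := Matrix.trace_mul_comm w (V * x₂ * η₁)
  have c₁₁ := Matrix.trace_mul_comm w (V * y₂ * ξ₁)
  have c₁₂ := Matrix.trace_mul_comm η₂ (W * v * x₁)
  have c₁₃ := Matrix.trace_mul_comm ξ₂ (W * v * y₁)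
  simp only [Matrix.mul_sub, Matrix.sub_mul, Matrix.mul_add, Matrix.add_mul, Matrix.trace_sub,
    Matrix.trace_add, Matrix.mul_neg, Matrix.trace_neg, Matrix.mul_assoc, Matrix.mul_smul,
    Matrix.smul_mul, Matrix.trace_smul, smul_eq_mul, Matrix.one_mul]
    at c₁ c₂ c₃ c₄ c₅ c₆ c₇ c₈ c₉ c₁₀ c₁₁ c₁₂ c₁₃ ⊢
  linear_combination (1 / 2) * (c₁ - c₂ - c₃ - c₄ + c₅ + c₆ - c₇ - c₈ + c₉ + c₁₀ - c₁₁ - c₁₂ + c₁₃)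

/-- The matrix `N` such that the covector `(ξ, xᵀ)` at the point `(g V, Wᵀ h)`, pulled back along the
dependence of `g = g₊` and `h = g₋⁻¹` on the first factor, is `tr (δL N)` with `L = g h`. The middle
factor is the diagonal component in the double of the pair `(V xᵀ g, h ξ Wᵀ)`, and `gi`, `hi` stand
for the inverses of `g`, `h`. -/
def momentumCovector (R : Matrix n n ℂ →ₗ[ℂ] Matrix n n ℂ) (g gi h hi : Matrix n n ℂ)
    (V : Matrix n d₂ ℂ) (W x : Matrix d₂ n ℂ) (ξ : Matrix n d₂ ℂ) : Matrix n n ℂ :=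
  hi * (plusPart R (h * ξ * W) - minusPart R (V * (x * g))) * gi

/-- The defining property of `N`: the pair `(L N, N L)` differs from `(g V xᵀ, ξ Wᵀ h)` by an element
of the Lie algebra of the dual group. -/
theorem momentumCovector_spec (R : Matrix n n ℂ →ₗ[ℂ] Matrix n n ℂ) {g gi h hi : Matrix n n ℂ}
    (hg : g * gi = 1) (hg' : gi * g = 1) (hh : h * hi = 1) (hh' : hi * h = 1)
    (ad : ∀ Z : Matrix n n ℂ, ∃ Z', g * plusPart R Z * gi = plusPart R Z' ∧
      hi * minusPart R Z * h = minusPart R Z')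
    (V : Matrix n d₂ ℂ) (W x : Matrix d₂ n ℂ) (ξ : Matrix n d₂ ℂ) :
    ∃ Z, g * h * momentumCovector R g gi h hi V W x ξ = g * V * x + plusPart R Z ∧
      momentumCovector R g gi h hi V W x ξ * (g * h) = ξ * (W * h) + minusPart R Z := by
  obtain ⟨Z', e₁, e₂⟩ := ad (h * ξ * W - V * (x * g))
  have f₁ : plusPart R (h * ξ * W) - minusPart R (V * (x * g)) =
      V * (x * g) + plusPart R (h * ξ * W - V * (x * g)) := by
    simp only [plusPart, minusPart, map_sub]
    module
  have f₂ : plusPart R (h * ξ * W) - minusPart R (V * (x * g)) =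
      h * ξ * W + minusPart R (h * ξ * W - V * (x * g)) := by
    simp only [plusPart, minusPart, map_sub]
    module
  refine ⟨Z', ?_, ?_⟩
  · have : g * h * momentumCovector R g gi h hi V W x ξ = g * (h * hi) *
        (plusPart R (h * ξ * W) - minusPart R (V * (x * g))) * gi := by
      simp only [momentumCovector, mul_assoc]
    rw [this, hh, mul_one, f₁, mul_add, add_mul, e₁]
    congr 1
    simp only [Matrix.mul_assoc, hg, Matrix.mul_one]
  · have : momentumCovector R g gi h hi V W x ξ * (g * h) = hi *
        (plusPart R (h * ξ * W) - minusPart R (V * (x * g))) * (gi * g) * h := by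
      simp only [momentumCovector, mul_assoc]
    rw [this, hg', mul_one, f₂, mul_add, add_mul, e₂]
    congr 1
    simp only [← Matrix.mul_assoc, hh', Matrix.one_mul]

variable [DecidableEq d₁]

/-- The Poisson property of the concatenated semidirect map, on the level of covectors: `g`, `h`
stand for `g₊`, `g₋⁻¹`, and the hypothesis `ad` is the invariance of the Lie algebra of the dual
group under the adjoint action of `(g₊, g₋)`. -/
theorem bivector_semidirect {R : Matrix n n ℂ →ₗ[ℂ] Matrix n n ℂ}
    {ρ₁ : Matrix d₁ d₁ ℂ →ₗ[ℂ] Matrix d₁ d₁ ℂ} (hR : IsRMatrix R) (hρ₁ : IsRMatrix ρ₁)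
    (ρ₂ : Matrix d₂ d₂ ℂ →ₗ[ℂ] Matrix d₂ d₂ ℂ) (lam : ℂ)
    {g gi h hi : Matrix n n ℂ}
    (hg : g * gi = 1) (hg' : gi * g = 1) (hh : h * hi = 1) (hh' : hi * h = 1)
    (ad : ∀ Z : Matrix n n ℂ, ∃ Z', g * plusPart R Z * gi = plusPart R Z' ∧
      hi * minusPart R Z * h = minusPart R Z')
    (v : Matrix n d₁ ℂ) (V : Matrix n d₂ ℂ) (w : Matrix d₁ n ℂ) (W : Matrix d₂ n ℂ)
    (hL : g * h = lam • 1 + v * w)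
    (x₁ : Matrix d₁ n ℂ) (x₂ : Matrix d₂ n ℂ) (ξ₁ : Matrix n d₁ ℂ) (ξ₂ : Matrix n d₂ ℂ)
    (y₁ : Matrix d₁ n ℂ) (y₂ : Matrix d₂ n ℂ) (η₁ : Matrix n d₁ ℂ) (η₂ : Matrix n d₂ ℂ)
    (N N' : Matrix n n ℂ) (hN : N = momentumCovector R g gi h hi V W x₂ ξ₂)
    (hN' : N' = momentumCovector R g gi h hi V W y₂ η₂) :
    bivector R ρ₁ lam v w (x₁ + w * N) (ξ₁ + N * v) (y₁ + w * N') (η₁ + N' * v)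
      + bivector R ρ₂ 1 V W (x₂ * g) (h * ξ₂) (y₂ * g) (h * η₂) =
    bivector R (blockR ρ₁ ρ₂) lam (Matrix.fromCols v (g * V)) (Matrix.fromRows w (W * h))
      (Matrix.fromRows x₁ x₂) (Matrix.fromCols ξ₁ ξ₂) (Matrix.fromRows y₁ y₂)
      (Matrix.fromCols η₁ η₂) := by
  obtain ⟨Z, p, q⟩ := momentumCovector_spec R hg hg' hh hh' ad V W x₂ ξ₂
  obtain ⟨Z', p', q'⟩ := momentumCovector_spec R hg hg' hh hh' ad V W y₂ η₂
  rw [← hN] at p q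
  rw [← hN'] at p' q'
  -- elements of the double which differ by one of the Lie algebra of the dual group have the same
  -- component along the diagonal
  have diag (A B Z P Q : Matrix n n ℂ) (hP : P = A + plusPart R Z) (hQ : Q = B + minusPart R Z) :
      plusPart R Q - minusPart R P = plusPart R B - minusPart R A := by
    have := plusPart_minusPart_comm R Z
    have e₁ : plusPart R Q = plusPart R B + plusPart R (minusPart R Z) := by
      rw [hQ]; exact map_add (plusL R) _ _
    have e₂ : minusPart R P = minusPart R A + minusPart R (plusPart R Z) := by
      rw [hP]; exact map_add (minusL R) _ _
    rw [e₁, e₂, this]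
    abel
  have hK := diag _ _ _ _ _ p q
  have hK' := diag _ _ _ _ _ p' q'
  have m := bivector_add_momentum hR hρ₁ lam (v, w) (ξ₁, x₁) (η₁, y₁) (g * h) N N' _ _ hL
    hK.symm hK'.symm
  have t := trace_lie_momentum hR (g * V * x₂) (ξ₂ * (W * h)) _ _ _ _ _ _ _ p' q' rfl rfl
  have dr := bivector_dressing R ρ₂ V (g * V) W (W * h) g h _ rfl rfl rfl x₂ ξ₂ y₂ η₂
  have bl := bivector_blockR R ρ₁ ρ₂ lam v (g * V) w (W * h) x₁ x₂ ξ₁ ξ₂ y₁ y₂ η₁ η₂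
  have u₁ : (g * V * x₂ * (g * h * N')).trace = (V * (x₂ * g) *
      (plusPart R (h * η₂ * W) - minusPart R (V * (y₂ * g)))).trace := by
    have : g * h * N' = g * (h * hi) *
        (plusPart R (h * η₂ * W) - minusPart R (V * (y₂ * g))) * gi := by
      simp only [hN', momentumCovector, mul_assoc]
    rw [this, hh, mul_one, ← mul_assoc, Matrix.trace_mul_comm]
    simp only [← Matrix.mul_assoc, hg', Matrix.one_mul]
  have u₂ : (ξ₂ * (W * h) * (N' * (g * h))).trace = (h * ξ₂ * W *
      (plusPart R (h * η₂ * W) - minusPart R (V * (y₂ * g)))).trace := by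
    have : N' * (g * h) = hi *
        (plusPart R (h * η₂ * W) - minusPart R (V * (y₂ * g))) * (gi * g) * h := by
      simp only [hN', momentumCovector, mul_assoc]
    rw [this, hg', mul_one, ← mul_assoc, Matrix.trace_mul_comm]
    simp only [← Matrix.mul_assoc]
    rw [Matrix.mul_assoc _ h hi, hh, Matrix.mul_one]
  rw [Matrix.sub_mul, Matrix.trace_sub, ← u₁, ← u₂] at dr
  have w₁ := trace_mul_plusPart_minusPart hR (g * V * x₂) (ξ₂ * (W * h)) (v * y₁ - η₁ * w)
  have w₂ := trace_mul_plusPart_minusPart hR (g * V * y₂) (η₂ * (W * h)) (v * x₁ - ξ₁ * w)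
  have w₃ := hR.skew (v * x₁ - ξ₁ * w) (g * V * y₂ - η₂ * (W * h))
  rw [Matrix.trace_mul_comm] at w₃
  rw [← hL] at bl
  simp only at m
  have z₁ : (g * V * x₂ * (g * V) * y₂).trace = (g * V * x₂ * (g * V * y₂)).trace := by
    simp only [Matrix.mul_assoc]
  have z₂ : (ξ₂ * (W * h) * η₂ * (W * h)).trace = (ξ₂ * (W * h) * (η₂ * (W * h))).trace := by
    simp only [Matrix.mul_assoc]
  have z₃ : (W * h * (g * V) * (x₂ * η₂)).trace = (g * V * x₂ * (η₂ * (W * h))).trace := by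
    rw [Matrix.mul_assoc, Matrix.trace_mul_comm]
    simp only [Matrix.mul_assoc]
  have z₄ : (W * h * (g * V) * (y₂ * ξ₂)).trace = (ξ₂ * (W * h) * (g * V * y₂)).trace := by
    rw [← Matrix.mul_assoc, Matrix.trace_mul_comm]
    simp only [Matrix.mul_assoc]
  rw [bl, m, t]
  rw [z₁, z₂] at dr
  rw [Matrix.mul_sub (W * h * (g * V)), Matrix.trace_sub, z₃, z₄]
  generalize v * x₁ - ξ₁ * w = A₁ at *
  generalize v * y₁ - η₁ * w = A₁' at *
  generalize g * V * x₂ = A at *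
  generalize g * V * y₂ = A' at *
  generalize ξ₂ * (W * h) = B at *
  generalize η₂ * (W * h) = B' at *
  rw [w₁, w₂]
  rw [eq_comm, ← sub_eq_zero] at dr w₃ ⊢
  rw [← dr]
  clear dr w₁ w₂ bl m t u₁ u₂ p q p' q'
  simp only [plusPart, minusPart, map_sub, Matrix.mul_sub, Matrix.sub_mul, Matrix.mul_add,
    Matrix.add_mul, Matrix.trace_sub, Matrix.trace_add, Matrix.mul_smul, 
    Matrix.trace_smul, smul_eq_mul] at w₃ ⊢
  linear_combination (1 / 2) * w₃

end

/-! ### Holomorphic branches of the factorization -/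

section
variable {n d₁ d₂ : Type*}

/-- Concatenation as a linear map. -/
def concatL : Pairs n d₁ × Pairs n d₂ →ₗ[ℂ] Pairs n (d₁ ⊕ d₂) where
  toFun := concat
  map_add' p q := by
    ext i j
    · rcases j with j | j <;> rfl
    · rcases i with i | i <;> rfl
  map_smul' c p := by
    ext i j
    · rcases j with j | j <;> rfl
    · rcases i with i | i <;> rfl

/-- Restriction of a concatenated pair to the two factors. -/
def splitL : Pairs n (d₁ ⊕ d₂) →ₗ[ℂ] Pairs n d₁ × Pairs n d₂ where
  toFun z := ((z.1.toCols₁, z.2.toRows₁), (z.1.toCols₂, z.2.toRows₂))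
  map_add' _ _ := rfl
  map_smul' _ _ := rfl

theorem splitL_concat (p : Pairs n d₁ × Pairs n d₂) : splitL (concat p) = p := rfl

theorem concat_splitL (z : Pairs n (d₁ ⊕ d₂)) : concat (splitL z) = z :=
  Prod.ext (Matrix.fromCols_toCols _) (Matrix.fromRows_toRows _)

end

section
variable {l m n : Type*} [Fintype l] [Fintype m] [Fintype n]

theorem analyticAt_bilinear {E E₁ E₂ E₃ : Type*} [NormedAddCommGroup E] [NormedSpace ℂ E]
    [NormedAddCommGroup E₁] [NormedSpace ℂ E₁] [NormedAddCommGroup E₂] [NormedSpace ℂ E₂]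
    [NormedAddCommGroup E₃] [NormedSpace ℂ E₃] [FiniteDimensional ℂ E₁] [FiniteDimensional ℂ E₂]
    (B : E₁ →ₗ[ℂ] E₂ →ₗ[ℂ] E₃) {f : E → E₁} {g : E → E₂} {p : E} (hf : AnalyticAt ℂ f p)
    (hg : AnalyticAt ℂ g p) : AnalyticAt ℂ (fun q => B (f q) (g q)) p := by
  let B' : E₁ →L[ℂ] E₂ →L[ℂ] E₃ :=
    LinearMap.toContinuousLinearMap (LinearMap.toContinuousLinearMap.toLinearMap ∘ₗ B)
  exact AnalyticAt.comp (g := fun x : E₁ × E₂ => B' x.1 x.2) (f := fun q => (f q, g q))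
    (B'.analyticAt_bilinear (f p, g p)) (hf.prod hg)

theorem analyticAt_matrix_mul {E : Type*} [NormedAddCommGroup E] [NormedSpace ℂ E]
    {f : E → Matrix l m ℂ} {g : E → Matrix m n ℂ} {p : E} (hf : AnalyticAt ℂ f p)
    (hg : AnalyticAt ℂ g p) : AnalyticAt ℂ (fun q => f q * g q) p := by
  exact analyticAt_bilinear (LinearMap.mk₂ ℂ (fun A C => A * C) Matrix.add_mul
    (fun c A C => Matrix.smul_mul c A C)
      Matrix.mul_add (fun c A C => Matrix.mul_smul A c C)) hf hg

variable [DecidableEq n]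

theorem eventually_inv_eq {E : Type*} [NormedAddCommGroup E] 
    {P : Matrix n n ℂ →ₗ[ℂ] Matrix n n ℂ} {X : E → Matrix n n ℂ} {m₀ : E}
    {g : E → Matrix.GeneralLinearGroup n ℂ}
    (h : ∀ᶠ m in 𝓝 m₀, (g m : Matrix n n ℂ) = NormedSpace.exp (P (X m)) * (g m₀ : Matrix n n ℂ)) :
    ∀ᶠ m in 𝓝 m₀, (((g m)⁻¹ : Matrix.GeneralLinearGroup n ℂ) : Matrix n n ℂ) =
      (((g m₀)⁻¹ : Matrix.GeneralLinearGroup n ℂ) : Matrix n n ℂ) *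
        NormedSpace.exp (P (-X m)) := by
  filter_upwards [h] with m hm
  rw [Matrix.coe_units_inv, hm, Matrix.mul_inv_rev, map_neg, Matrix.exp_neg, Matrix.coe_units_inv]

theorem analyticAt_exp_linear {E : Type*} [NormedAddCommGroup E] [NormedSpace ℂ E]
    (P : Matrix n n ℂ →ₗ[ℂ] Matrix n n ℂ) {X : E → Matrix n n ℂ} {m₀ : E}
    (hX : AnalyticAt ℂ X m₀) : AnalyticAt ℂ (fun m => NormedSpace.exp (P (X m))) m₀ := by
  have h := analyticAt_linearMap P hX
  exact (NormedSpace.exp_analytic (𝕂 := ℂ) (P (X m₀))).comp (f := fun m => P (X m)) h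

theorem hasDerivAt_exp_linear (P : Matrix n n ℂ →ₗ[ℂ] Matrix n n ℂ) {X : ℂ → Matrix n n ℂ}
    {X' : Matrix n n ℂ} (hX : HasDerivAt X X' 0) (h0 : X 0 = 0) :
    HasDerivAt (fun t => NormedSpace.exp (P (X t))) (P X') 0 := by
  have h : HasFDerivAt (NormedSpace.exp : Matrix n n ℂ → Matrix n n ℂ)
      (1 : Matrix n n ℂ →L[ℂ] Matrix n n ℂ) (P (X 0)) := by
    rw [h0, map_zero]
    exact hasFDerivAt_exp_zero
  exact h.comp_hasDerivAt 0 (hasDerivAt_linearMap P hX)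

end

section
variable {n d : Type*} [Fintype n] [Fintype d] [DecidableEq n]

theorem IsFactorBranch.analyticAt {R : Matrix n n ℂ →ₗ[ℂ] Matrix n n ℂ} {lam : ℂ}
    {U : Set (Pairs n d)} {gp gm : Pairs n d → Matrix.GeneralLinearGroup n ℂ}
    (h : IsFactorBranch R lam U gp gm) {m₀ : Pairs n d} (hm : m₀ ∈ U) :
    AnalyticAt ℂ (fun m => (gp m : Matrix n n ℂ)) m₀ ∧
    AnalyticAt ℂ (fun m => (((gp m)⁻¹ : Matrix.GeneralLinearGroup n ℂ) : Matrix n n ℂ)) m₀ ∧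
    AnalyticAt ℂ (fun m => (gm m : Matrix n n ℂ)) m₀ ∧
    AnalyticAt ℂ (fun m => (((gm m)⁻¹ : Matrix.GeneralLinearGroup n ℂ) : Matrix n n ℂ)) m₀ := by
  obtain ⟨X, hX, -, hg⟩ := h.holomorphic m₀ hm
  have hgp := hg.mono fun m hm => hm.1
  have hgm := hg.mono fun m hm => hm.2
  refine ⟨?_, ?_, ?_, ?_⟩
  · exact (analyticAt_matrix_mul (analyticAt_exp_linear (plusL R) hX) analyticAt_const).congr
      (Filter.EventuallyEq.symm hgp)
  · exact (analyticAt_matrix_mul analyticAt_const (analyticAt_exp_linear (plusL R) hX.neg)).congr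
      (Filter.EventuallyEq.symm (eventually_inv_eq (P := plusL R) hgp))
  · exact (analyticAt_matrix_mul (analyticAt_exp_linear (minusL R) hX) analyticAt_const).congr
      (Filter.EventuallyEq.symm hgm)
  · exact (analyticAt_matrix_mul analyticAt_const (analyticAt_exp_linear (minusL R) hX.neg)).congr
      (Filter.EventuallyEq.symm (eventually_inv_eq (P := minusL R) hgm))

/-- The derivatives of the factors along a line, and of the equation that they satisfy. -/
theorem IsFactorBranch.hasDerivAt {R : Matrix n n ℂ →ₗ[ℂ] Matrix n n ℂ} {lam : ℂ}
    {U : Set (Pairs n d)} {gp gm : Pairs n d → Matrix.GeneralLinearGroup n ℂ}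
    (h : IsFactorBranch R lam U gp gm) {m₀ : Pairs n d} (hm : m₀ ∈ U) (u : Pairs n d) :
    ∃ X' : Matrix n n ℂ,
      HasDerivAt (fun t : ℂ => (gp (m₀ + t • u) : Matrix n n ℂ))
        (plusPart R X' * (gp m₀ : Matrix n n ℂ)) 0 ∧
      HasDerivAt (fun t : ℂ =>
        (((gm (m₀ + t • u))⁻¹ : Matrix.GeneralLinearGroup n ℂ) : Matrix n n ℂ))
        (-((((gm m₀)⁻¹ : Matrix.GeneralLinearGroup n ℂ) : Matrix n n ℂ) * minusPart R X')) 0 ∧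
      plusPart R X' * (lam • (1 : Matrix n n ℂ) + m₀.1 * m₀.2)
        - (lam • (1 : Matrix n n ℂ) + m₀.1 * m₀.2) * minusPart R X' = u.1 * m₀.2 + m₀.1 * u.2 := by
  obtain ⟨X, hX, hX0, hg⟩ := h.holomorphic m₀ hm
  have hgp := hg.mono fun m hm => hm.1
  have hgm := hg.mono fun m hm => hm.2
  have hp : m₀ + (0 : ℂ) • u = m₀ := by simp
  have line : HasDerivAt (fun t : ℂ => m₀ + t • u) u 0 := hasDerivAt_line m₀ u
  have lim : Filter.Tendsto (fun t : ℂ => m₀ + t • u) (𝓝 0) (𝓝 m₀) := by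
    have := line.continuousAt.tendsto
    rw [hp] at this
    exact this
  have hX' := hX.differentiableAt.hasFDerivAt
  rw [← hp] at hX'
  have hX' := hX'.comp_hasDerivAt (0 : ℂ) line
  rw [hp] at hX'
  set X' := fderiv ℂ X m₀ u with hXdef
  have hX0' : (X ∘ fun t : ℂ => m₀ + t • u) 0 = 0 := by
    rw [Function.comp_apply, hp, hX0]
  have d₁ : HasDerivAt (fun t : ℂ => (gp (m₀ + t • u) : Matrix n n ℂ))
        (plusPart R X' * (gp m₀ : Matrix n n ℂ)) 0 :=
    ((hasDerivAt_exp_linear (plusL R) hX' hX0').mul_const (gp m₀ : Matrix n n ℂ)).congr_of_eventuallyEq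
      (lim.eventually hgp)
  have d₂ : HasDerivAt (fun t : ℂ =>
        (((gm (m₀ + t • u))⁻¹ : Matrix.GeneralLinearGroup n ℂ) : Matrix n n ℂ))
        (-((((gm m₀)⁻¹ : Matrix.GeneralLinearGroup n ℂ) : Matrix n n ℂ) * minusPart R X')) 0 := by
    have := ((hasDerivAt_exp_linear (minusL R) hX'.neg (by
      rw [Pi.neg_apply, hX0', neg_zero])).const_mul
      (((gm m₀)⁻¹ : Matrix.GeneralLinearGroup n ℂ) : Matrix n n ℂ)).congr_of_eventuallyEq
      (lim.eventually (eventually_inv_eq (P := minusL R) hgm))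
    rw [map_neg, mul_neg] at this
    exact this
  refine ⟨X', d₁, d₂, ?_⟩
  have hL := h.factor m₀ hm
  rw [Units.val_mul] at hL
  have prod : HasDerivAt
      (fun t : ℂ => lam • (1 : Matrix n n ℂ) + (m₀.1 + t • u.1) * (m₀.2 + t • u.2))
      (u.1 * m₀.2 + m₀.1 * u.2) 0 := by
    have e : (fun t : ℂ => lam • (1 : Matrix n n ℂ) + (m₀.1 + t • u.1) * (m₀.2 + t • u.2)) =
        fun t : ℂ => (lam • (1 : Matrix n n ℂ) + m₀.1 * m₀.2) +
          (t • (u.1 * m₀.2 + m₀.1 * u.2) + (t * t) • (u.1 * u.2)) := by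
      funext t
      simp only [Matrix.add_mul, Matrix.mul_add, Matrix.smul_mul, Matrix.mul_smul]
      module
    rw [e]
    have h₁ := (hasDerivAt_id (0 : ℂ)).smul_const (u.1 * m₀.2 + m₀.1 * u.2)
    have h₂ := ((hasDerivAt_id (0 : ℂ)).mul (hasDerivAt_id (0 : ℂ))).smul_const (u.1 * u.2)
    have := (h₁.add h₂).const_add (lam • (1 : Matrix n n ℂ) + m₀.1 * m₀.2)
    simp only [id, mul_one, add_zero, zero_smul, one_smul, mul_zero] at this
    exact this
  have := (prod.congr_of_eventuallyEq (lim.eventually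
    (Filter.eventually_of_mem (h.isOpen.mem_nhds hm) fun m hm => (Units.val_mul _ _).symm.trans
      (h.factor m hm)))).unique (d₁.mul d₂)
  rw [this, hp, ← hL]
  noncomm_ring
end

/-! ### The concatenated semidirect map -/

section
variable {n d : Type*} [Fintype n] [Fintype d]

/-- The derivative of a function along a line, by the chain rule for a curve in the target. -/
theorem fderiv_comp_line {E : Type*} [NormedAddCommGroup E] [NormedSpace ℂ E] {F : E → ℂ}
    {T : Pairs n d → E} {p u : Pairs n d} {c' : E} (hF : DifferentiableAt ℂ F (T p))
    (hT : DifferentiableAt ℂ T p) (hc : HasDerivAt (fun t : ℂ => T (p + t • u)) c' 0) :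
    fderiv ℂ (F ∘ T) p u = fderiv ℂ F (T p) c' := by
  have hp : p + (0 : ℂ) • u = p := by simp
  have h₁ := hT.hasFDerivAt
  rw [← hp] at h₁
  have h₂ := (h₁.comp_hasDerivAt (0 : ℂ) (hasDerivAt_line p u)).unique hc
  rw [hp] at h₂
  have h₃ : fderiv ℂ (F ∘ T) p = (fderiv ℂ F (T p)).comp (fderiv ℂ T p) :=
    (hF.hasFDerivAt.comp p hT.hasFDerivAt).fderiv
  rw [h₃]
  exact congrArg _ h₂

variable [DecidableEq n] [DecidableEq d]

theorem gradOf_fderiv_linear (X : Matrix d n ℂ) (P : Matrix n d ℂ) (p : Pairs n d) :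
    gradOf (fderiv ℂ (fun z : Pairs n d => (X * z.1).trace + (z.2 * P).trace) p) = (P, X) := by
  let f : Pairs n d →ₗ[ℂ] ℂ :=
    { toFun := fun z => (X * z.1).trace + (z.2 * P).trace
      map_add' := fun z z' => by
        simp only [Prod.fst_add, Prod.snd_add, Matrix.mul_add, Matrix.add_mul, Matrix.trace_add]
        ring
      map_smul' := fun c z => by
        simp only [Prod.smul_fst, Prod.smul_snd, Matrix.mul_smul, Matrix.smul_mul,
          Matrix.trace_smul, smul_eq_mul, RingHom.id_apply]
        ring }
  have e : fderiv ℂ (fun z : Pairs n d => (X * z.1).trace + (z.2 * P).trace) p =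
      LinearMap.toContinuousLinearMap f := (LinearMap.toContinuousLinearMap f).hasFDerivAt.fderiv
  rw [e]
  refine gradOf_eq _ _ fun u => ?_
  change (X * u.1).trace + (u.2 * P).trace = _
  rw [Matrix.trace_mul_comm X]

end

section
variable {n d₁ d₂ : Type*} [Fintype n] [DecidableEq n]

/-- The inverse of the concatenated semidirect map. -/
def semidirectInv (gp gm : Pairs n d₁ → Matrix.GeneralLinearGroup n ℂ) (z : Pairs n (d₁ ⊕ d₂)) :
    Pairs n d₁ × Pairs n d₂ :=
  ((splitL z).1, ((((gp (splitL z).1)⁻¹ : Matrix.GeneralLinearGroup n ℂ) : Matrix n n ℂ) *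
    (splitL z).2.1, (splitL z).2.2 * (gm (splitL z).1 : Matrix n n ℂ)))

theorem semidirectInv_concat (gp gm : Pairs n d₁ → Matrix.GeneralLinearGroup n ℂ)
    (p : Pairs n d₁ × Pairs n d₂) :
    semidirectInv gp gm (concat (semidirectMap gp gm p)) = p := by
  simp only [semidirectInv, splitL_concat, semidirectMap]
  rw [← Matrix.mul_assoc (_ : Matrix n n ℂ), Units.inv_mul, Matrix.one_mul, Matrix.mul_assoc,
    Units.inv_mul, Matrix.mul_one]

theorem image_semidirect (gp gm : Pairs n d₁ → Matrix.GeneralLinearGroup n ℂ)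
    (U : Set (Pairs n d₁)) :
    (fun p : Pairs n d₁ × Pairs n d₂ => concat (semidirectMap gp gm p)) '' (U ×ˢ Set.univ) =
      {z | (splitL z).1 ∈ U} := by
  ext z
  constructor
  · rintro ⟨p, hp, rfl⟩
    exact hp.1
  · intro hz
    refine ⟨semidirectInv gp gm z, ⟨hz, trivial⟩, ?_⟩
    change concat (semidirectMap gp gm (semidirectInv gp gm z)) = z
    conv_rhs => rw [← concat_splitL z]
    congr 1
    simp only [semidirectInv, semidirectMap]
    rw [← Matrix.mul_assoc (_ : Matrix n n ℂ), Units.mul_inv, Matrix.one_mul, Matrix.mul_assoc,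
      Units.mul_inv, Matrix.mul_one]

variable [Fintype d₁] [Fintype d₂]

theorem IsFactorBranch.analyticAt_semidirect {R : Matrix n n ℂ →ₗ[ℂ] Matrix n n ℂ} {lam : ℂ}
    {U : Set (Pairs n d₁)} {gp gm : Pairs n d₁ → Matrix.GeneralLinearGroup n ℂ}
    (h : IsFactorBranch R lam U gp gm) {p : Pairs n d₁ × Pairs n d₂} (hp : p.1 ∈ U) :
    AnalyticAt ℂ (fun p : Pairs n d₁ × Pairs n d₂ => concat (semidirectMap gp gm p)) p := by
  obtain ⟨h₁, -, -, h₄⟩ := h.analyticAt hp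
  have f : AnalyticAt ℂ (fun p : Pairs n d₁ × Pairs n d₂ => p.1) p := analyticAt_fst
  have g₁ := analyticAt_matrix_mul (h₁.comp f)
    (analyticAt_linearMap (LinearMap.fst ℂ _ _ ∘ₗ LinearMap.snd ℂ (Pairs n d₁) (Pairs n d₂))
      (f := fun p => p) (analyticAt_id (z := p)))
  have g₂ := analyticAt_matrix_mul
    (analyticAt_linearMap (LinearMap.snd ℂ _ _ ∘ₗ LinearMap.snd ℂ (Pairs n d₁) (Pairs n d₂))
      (f := fun p => p) (analyticAt_id (z := p))) (h₄.comp f)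
  exact analyticAt_linearMap concatL (f.prod (g₁.prod g₂))

theorem IsFactorBranch.analyticAt_semidirectInv {R : Matrix n n ℂ →ₗ[ℂ] Matrix n n ℂ} {lam : ℂ}
    {U : Set (Pairs n d₁)} {gp gm : Pairs n d₁ → Matrix.GeneralLinearGroup n ℂ}
    (h : IsFactorBranch R lam U gp gm) {z : Pairs n (d₁ ⊕ d₂)} (hz : (splitL z).1 ∈ U) :
    AnalyticAt ℂ (semidirectInv (d₂ := d₂) gp gm) z := by
  obtain ⟨-, h₂, h₃, -⟩ := h.analyticAt hz
  have f := analyticAt_linearMap (LinearMap.fst ℂ _ _ ∘ₗ splitL (n := n) (d₁ := d₁) (d₂ := d₂))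
    (f := fun p => p) (analyticAt_id (z := z))
  have g₁ := analyticAt_matrix_mul (AnalyticAt.comp (f := fun z => (splitL z).1) h₂ f)
    (analyticAt_linearMap (LinearMap.fst ℂ _ _ ∘ₗ LinearMap.snd ℂ (Pairs n d₁) (Pairs n d₂)
      ∘ₗ splitL) (f := fun p => p) (analyticAt_id (z := z)))
  have g₂ := analyticAt_matrix_mul
    (analyticAt_linearMap (LinearMap.snd ℂ _ _ ∘ₗ LinearMap.snd ℂ (Pairs n d₁) (Pairs n d₂)
      ∘ₗ splitL) (f := fun p => p) (analyticAt_id (z := z)))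
    (AnalyticAt.comp (f := fun z => (splitL z).1) h₃ f)
  exact f.prod (g₁.prod g₂)

theorem hasDerivAt_matrix_mul_const {l m k : Type*} [Fintype l] [Fintype m] [Fintype k]
    {f : ℂ → Matrix l m ℂ} {f' : Matrix l m ℂ} (hf : HasDerivAt f f' 0) (A : Matrix m k ℂ) :
    HasDerivAt (fun t => f t * A) (f' * A) 0 :=
  hasDerivAt_linearMap (E' := Matrix l k ℂ) { toFun := fun B => B * A
                                              map_add' := fun B C => Matrix.add_mul B C A
                                              map_smul' := fun c B => Matrix.smul_mul c B A } hf

theorem hasDerivAt_matrix_const_mul {l m k : Type*} [Fintype l] [Fintype m] [Fintype k]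
    {f : ℂ → Matrix l m ℂ} {f' : Matrix l m ℂ} (hf : HasDerivAt f f' 0) (A : Matrix k l ℂ) :
    HasDerivAt (fun t => A * f t) (A * f') 0 :=
  hasDerivAt_linearMap (E' := Matrix k m ℂ) { toFun := fun B => A * B
                                              map_add' := fun B C => Matrix.mul_add A B C
                                              map_smul' := fun c B => Matrix.mul_smul A c B } hf

variable [DecidableEq d₁] [DecidableEq d₂]

theorem apply_concat (D : Pairs n (d₁ ⊕ d₂) →L[ℂ] ℂ) (p : Pairs n d₁ × Pairs n d₂) :
    D (concat p) = (p.1.1 * (splitL (gradOf D)).1.2).trace + (p.1.2 * (splitL (gradOf D)).1.1).trace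
      + ((p.2.1 * (splitL (gradOf D)).2.2).trace + (p.2.2 * (splitL (gradOf D)).2.1).trace) := by
  have e : concat (splitL (gradOf D)) = gradOf D := concat_splitL _
  rw [apply_eq_trace, trace_offDiag_mul, ← e]
  simp only [splitL_concat]
  simp only [concat, Matrix.fromCols_mul_fromRows, Matrix.fromRows_mul_fromCols, trace_fromBlocks,
    Matrix.trace_add]
  ring

/-- The gradient of `F ∘ T` along the first factor, where `T` is the concatenated semidirect map:
the differential of the momentum map is added to the first part of the gradient of `F`. -/
theorem IsFactorBranch.gradOf_fst {R : Matrix n n ℂ →ₗ[ℂ] Matrix n n ℂ} (hR : IsRMatrix R)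
    {lam : ℂ} {U : Set (Pairs n d₁)} {gp gm : Pairs n d₁ → Matrix.GeneralLinearGroup n ℂ}
    (h : IsFactorBranch R lam U gp gm) {m : Pairs n d₁} (hm : m ∈ U) (q : Pairs n d₂)
    {F : Pairs n (d₁ ⊕ d₂) → ℂ}
    (hF : DifferentiableAt ℂ F (concat (semidirectMap gp gm (m, q))))
    (c : Pairs n d₁ × Pairs n d₂)
    (hc : splitL (gradOf (fderiv ℂ F (concat (semidirectMap gp gm (m, q))))) = c)
    (N Z : Matrix n n ℂ)
    (hN : (lam • (1 : Matrix n n ℂ) + m.1 * m.2) * N =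
      (gp m : Matrix n n ℂ) * q.1 * c.2.2 + plusPart R Z)
    (hN' : N * (lam • (1 : Matrix n n ℂ) + m.1 * m.2) =
      c.2.1 * (q.2 * (((gm m)⁻¹ : Matrix.GeneralLinearGroup n ℂ) : Matrix n n ℂ))
        + minusPart R Z) :
    gradOf (fderiv ℂ (fun m => F (concat (semidirectMap gp gm (m, q)))) m) =
      (c.1.1 + N * m.1, c.1.2 + m.2 * N) := by
  refine gradOf_eq _ _ fun u => ?_
  obtain ⟨X', d₁, d₂, hX'⟩ := h.hasDerivAt hm u
  have e : HasDerivAt (fun t : ℂ => concat (semidirectMap gp gm (m + t • u, q)))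
      (concat (u, (plusPart R X' * (gp m : Matrix n n ℂ) * q.1,
        q.2 * -((((gm m)⁻¹ : Matrix.GeneralLinearGroup n ℂ) : Matrix n n ℂ)
          * minusPart R X')))) 0 :=
    hasDerivAt_linearMap concatL ((hasDerivAt_line m u).prodMk
      ((hasDerivAt_matrix_mul_const d₁ q.1).prodMk (hasDerivAt_matrix_const_mul d₂ q.2)))
  have hT : DifferentiableAt ℂ (fun m => concat (semidirectMap gp gm (m, q))) m :=
    DifferentiableAt.comp (f := fun m => (m, q)) m
      (h.analyticAt_semidirect (p := (m, q)) hm).differentiableAt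
      (differentiableAt_id.prodMk (differentiableAt_const q))
  have k : fderiv ℂ (fun m => F (concat (semidirectMap gp gm (m, q)))) m u =
      fderiv ℂ F (concat (semidirectMap gp gm (m, q))) (concat
        (u, (plusPart R X' * (gp m : Matrix n n ℂ) * q.1,
        q.2 * -((((gm m)⁻¹ : Matrix.GeneralLinearGroup n ℂ) : Matrix n n ℂ)
          * minusPart R X')))) := fderiv_comp_line hF hT e
  rw [k, apply_concat, hc]
  clear k hT e d₁ d₂ hc hF
  have iso := hR.trace_isotropic X' Z
  have q₁ := congrArg (fun M => (plusPart R X' * M).trace) hN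
  have q₂ := congrArg (fun M => (minusPart R X' * M).trace) hN'
  have q₃ := congrArg (fun M => (M * N).trace) hX'
  have r₁ := Matrix.trace_mul_comm (minusPart R X' * c.2.1) (q.2 * (((gm m)⁻¹ :
    Matrix.GeneralLinearGroup n ℂ) : Matrix n n ℂ))
  have r₂ := Matrix.trace_mul_comm m.1 (u.2 * N)
  generalize lam • (1 : Matrix n n ℂ) + m.1 * m.2 = L at *
  have r₃ := Matrix.trace_mul_comm (minusPart R X') (N * L)
  have r₄ := Matrix.trace_mul_comm (L * minusPart R X') N
  simp only [Matrix.mul_add, Matrix.add_mul, Matrix.sub_mul, Matrix.trace_add, Matrix.trace_sub,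
    Matrix.mul_assoc, Matrix.mul_neg, Matrix.neg_mul, Matrix.trace_neg] at *
  linear_combination -q₁ + q₂ + r₁ + q₃ + r₂ - iso + r₄ - r₃

/-- The linear map `(V, Wᵀ) ↦ (g V, Wᵀ h)`. -/
def dressingL (g h : Matrix n n ℂ) : Pairs n d₂ →ₗ[ℂ] Pairs n d₂ where
  toFun q := (g * q.1, q.2 * h)
  map_add' p q := by simp [Matrix.mul_add, Matrix.add_mul]
  map_smul' c q := by simp

/-- The gradient of `F ∘ T` along the second factor. -/
theorem gradOf_snd (gp gm : Pairs n d₁ → Matrix.GeneralLinearGroup n ℂ) (m : Pairs n d₁)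
    (q : Pairs n d₂) {F : Pairs n (d₁ ⊕ d₂) → ℂ}
    (hF : DifferentiableAt ℂ F (concat (semidirectMap gp gm (m, q))))
    (c : Pairs n d₁ × Pairs n d₂)
    (hc : splitL (gradOf (fderiv ℂ F (concat (semidirectMap gp gm (m, q))))) = c) :
    gradOf (fderiv ℂ (fun q => F (concat (semidirectMap gp gm (m, q)))) q) =
      ((((gm m)⁻¹ : Matrix.GeneralLinearGroup n ℂ) : Matrix n n ℂ) * c.2.1,
        c.2.2 * (gp m : Matrix n n ℂ)) := by
  refine gradOf_eq _ _ fun u => ?_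
  have line := (hasDerivAt_const (0 : ℂ) m).prodMk
    (hasDerivAt_linearMap (dressingL (gp m : Matrix n n ℂ)
      (((gm m)⁻¹ : Matrix.GeneralLinearGroup n ℂ) : Matrix n n ℂ)) (hasDerivAt_line q u))
  have e : HasDerivAt (fun t : ℂ => concat (semidirectMap gp gm (m, q + t • u)))
      (concat ((0 : Pairs n d₁), ((gp m : Matrix n n ℂ) * u.1,
        u.2 * (((gm m)⁻¹ : Matrix.GeneralLinearGroup n ℂ) : Matrix n n ℂ)))) 0 :=
    hasDerivAt_linearMap concatL line
  have a₁ := analyticAt_linearMap (dressingL (gp m : Matrix n n ℂ)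
      (((gm m)⁻¹ : Matrix.GeneralLinearGroup n ℂ) : Matrix n n ℂ))
      (f := fun p : Pairs n d₂ => p) (analyticAt_id (z := q))
  have a₂ := analyticAt_linearMap concatL ((analyticAt_const (v := m)).prod a₁)
  have hT : DifferentiableAt ℂ (fun q : Pairs n d₂ => concat (semidirectMap gp gm (m, q))) q :=
    a₂.differentiableAt
  have k : fderiv ℂ (fun q => F (concat (semidirectMap gp gm (m, q)))) q u =
      fderiv ℂ F (concat (semidirectMap gp gm (m, q))) (concat
        ((0 : Pairs n d₁), ((gp m : Matrix n n ℂ) * u.1,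
        u.2 * (((gm m)⁻¹ : Matrix.GeneralLinearGroup n ℂ) : Matrix n n ℂ)))) :=
    fderiv_comp_line hF hT e
  rw [k, apply_concat, hc]
  have r := Matrix.trace_mul_comm (gp m : Matrix n n ℂ) (u.1 * c.2.2)
  simp only [Prod.fst_zero, Prod.snd_zero, Matrix.zero_mul, Matrix.trace_zero,
    Matrix.mul_assoc] at r ⊢
  rw [r]
  ring

/-- The concatenated semidirect map is a Poisson isomorphism onto an open set. -/
theorem IsFactorBranch.isPoissonIsoOn {R : Matrix n n ℂ →ₗ[ℂ] Matrix n n ℂ}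
    {ρ₁ : Matrix d₁ d₁ ℂ →ₗ[ℂ] Matrix d₁ d₁ ℂ} (hR : IsRMatrix R) (hρ₁ : IsRMatrix ρ₁)
    (ρ₂ : Matrix d₂ d₂ ℂ →ₗ[ℂ] Matrix d₂ d₂ ℂ) {lam : ℂ} {U : Set (Pairs n d₁)}
    {gp gm : Pairs n d₁ → Matrix.GeneralLinearGroup n ℂ} (h : IsFactorBranch R lam U gp gm) :
    IsPoissonIsoOn (prodBracket (bracket R ρ₁ lam) (bracket R ρ₂ 1))
      (bracket R (blockR ρ₁ ρ₂) lam)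
      (fun p : Pairs n d₁ × Pairs n d₂ => concat (semidirectMap gp gm p))
      (U ×ˢ (Set.univ : Set (Pairs n d₂))) where
  isOpen_source := h.isOpen.prod isOpen_univ
  isOpen_image := by
    rw [image_semidirect]
    exact h.isOpen.preimage (LinearMap.continuous_of_finiteDimensional
      (LinearMap.fst ℂ _ _ ∘ₗ splitL (n := n) (d₁ := d₁) (d₂ := d₂)))
  analytic p hp := h.analyticAt_semidirect hp.1
  inverse := by
    refine ⟨semidirectInv gp gm, ?_, fun p _ => semidirectInv_concat gp gm p⟩
    rw [image_semidirect]
    exact fun z hz => h.analyticAt_semidirectInv hz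
  bracket_comp := by
    rintro ⟨m, q⟩ ⟨hm, -⟩ F H hF hH
    have hL := h.factor m hm
    rw [Units.val_mul] at hL
    have ad (Z : Matrix n n ℂ) : ∃ Z', (gp m : Matrix n n ℂ) * plusPart R Z *
        (((gp m)⁻¹ : Matrix.GeneralLinearGroup n ℂ) : Matrix n n ℂ) = plusPart R Z' ∧
        (gm m : Matrix n n ℂ) * minusPart R Z *
        (((gm m)⁻¹ : Matrix.GeneralLinearGroup n ℂ) : Matrix n n ℂ) = minusPart R Z' :=
      hR.adjoint_mem (h.mem m hm) Z
    have u₁ := (gp m).mul_inv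
    have u₂ := (gp m).inv_mul
    have u₃ := (gm m).inv_mul
    have u₄ := (gm m).mul_inv
    obtain ⟨a, ha⟩ : ∃ a, splitL (gradOf (fderiv ℂ F (concat (semidirectMap gp gm (m, q))))) = a :=
      ⟨_, rfl⟩
    obtain ⟨b, hb⟩ : ∃ b, splitL (gradOf (fderiv ℂ H (concat (semidirectMap gp gm (m, q))))) = b :=
      ⟨_, rfl⟩
    obtain ⟨Z, s₁, s₂⟩ := momentumCovector_spec R u₁ u₂ u₃ u₄ ad q.1 q.2 a.2.2 a.2.1
    obtain ⟨Z', t₁, t₂⟩ := momentumCovector_spec R u₁ u₂ u₃ u₄ ad q.1 q.2 b.2.2 b.2.1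
    have key := bivector_semidirect hR hρ₁ ρ₂ lam u₁ u₂ u₃ u₄ ad m.1 q.1 m.2 q.2 hL
      a.1.2 a.2.2 a.1.1 a.2.1 b.1.2 b.2.2 b.1.1 b.2.1 _ _ rfl rfl
    rw [hL] at s₁ s₂ t₁ t₂
    have a₁ := h.gradOf_fst hR hm q hF.differentiableAt a ha _ Z s₁ s₂
    have b₁ := h.gradOf_fst hR hm q hH.differentiableAt b hb _ Z' t₁ t₂
    have a₂ := gradOf_snd gp gm m q hF.differentiableAt a ha
    have b₂ := gradOf_snd gp gm m q hH.differentiableAt b hb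
    have a₃ : gradOf (fderiv ℂ F (concat (semidirectMap gp gm (m, q)))) = concat a := by
      rw [← ha, concat_splitL]
    have b₃ : gradOf (fderiv ℂ H (concat (semidirectMap gp gm (m, q)))) = concat b := by
      rw [← hb, concat_splitL]
    change bracket R ρ₁ lam (fun m => F (concat (semidirectMap gp gm (m, q))))
        (fun m => H (concat (semidirectMap gp gm (m, q)))) m +
      bracket R ρ₂ 1 (fun q => F (concat (semidirectMap gp gm (m, q))))
        (fun q => H (concat (semidirectMap gp gm (m, q)))) q = _
    rw [bracket_eq_gradOf, bracket_eq_gradOf, bracket_eq_gradOf, a₁, b₁, a₂, b₂, a₃, b₃]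
    exact key

end

end SemidirectPB

end

theorem proposition5p2 {n d₁ d₂ : ℕ}
    (R : Matrix (Fin n) (Fin n) ℂ →ₗ[ℂ] Matrix (Fin n) (Fin n) ℂ)
    (ρ₁ : Matrix (Fin d₁) (Fin d₁) ℂ →ₗ[ℂ] Matrix (Fin d₁) (Fin d₁) ℂ)
    (ρ₂ : Matrix (Fin d₂) (Fin d₂) ℂ →ₗ[ℂ] Matrix (Fin d₂) (Fin d₂) ℂ)
    (hR : SemidirectPB.IsRMatrix R) (hρ₁ : SemidirectPB.IsRMatrix ρ₁)
    (hρ₂ : SemidirectPB.IsRMatrix ρ₂) (lam : ℂ) :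
    -- the block map is an r-matrix
    SemidirectPB.IsRMatrix (SemidirectPB.blockR ρ₁ ρ₂) ∧
    -- the bracket that it defines is a Poisson bracket on the concatenated space
    SemidirectPB.IsPoissonBracket
      (SemidirectPB.bracket R (SemidirectPB.blockR ρ₁ ρ₂) lam) ∧
    -- its value on linear functions (`X`, `Y` stand for the transposed matrices)
    (∀ (V : Matrix (Fin n) (Fin d₁ ⊕ Fin d₂) ℂ) (W : Matrix (Fin d₁ ⊕ Fin d₂) (Fin n) ℂ)
      (X Y : Matrix (Fin d₁ ⊕ Fin d₂) (Fin n) ℂ) (P Q : Matrix (Fin n) (Fin d₁ ⊕ Fin d₂) ℂ),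
      SemidirectPB.bracket R (SemidirectPB.blockR ρ₁ ρ₂) lam
          (fun z => (X * z.1).trace + (z.2 * P).trace)
          (fun z => (Y * z.1).trace + (z.2 * Q).trace) (V, W) =
        (1 / 2 : ℂ) *
          (-((V * X - P * W) * R (V * Y - Q * W)).trace
            - ((X * V - W * P) * SemidirectPB.blockR ρ₁ ρ₂ (Y * V - W * Q)).trace
            + (W * V * (X * Q - Y * P)).trace
            + (V * W * (Q * X - P * Y)).trace
            + 2 * lam * (X * Q - Y * P).trace)) ∧
    -- it is the bracket engendered by concatenation after the semidirect map, for every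
    -- holomorphic branch of the factorization on every open set
    (∀ (U : Set (SemidirectPB.Pairs (Fin n) (Fin d₁)))
      (gp gm : SemidirectPB.Pairs (Fin n) (Fin d₁) → Matrix.GeneralLinearGroup (Fin n) ℂ),
      SemidirectPB.IsFactorBranch R lam U gp gm →
      SemidirectPB.IsPoissonIsoOn
        (SemidirectPB.prodBracket (SemidirectPB.bracket R ρ₁ lam)
          (SemidirectPB.bracket R ρ₂ 1))
        (SemidirectPB.bracket R (SemidirectPB.blockR ρ₁ ρ₂) lam)
        (fun p : SemidirectPB.Pairs (Fin n) (Fin d₁) × SemidirectPB.Pairs (Fin n) (Fin d₂) =>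
          SemidirectPB.concat (SemidirectPB.semidirectMap gp gm p))
        (U ×ˢ (Set.univ : Set (SemidirectPB.Pairs (Fin n) (Fin d₂))))) := by
  refine ⟨hρ₁.blockR hρ₂, SemidirectPB.isPoissonBracket_bracket hR (hρ₁.blockR hρ₂) lam, ?_,
    fun U gp gm h => h.isPoissonIsoOn hR hρ₁ ρ₂⟩
  intro V W X Y P Q
  rw [SemidirectPB.bracket_eq_gradOf, SemidirectPB.gradOf_fderiv_linear,
    SemidirectPB.gradOf_fderiv_linear]
  rfl
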